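/- Let $T>0$, $a>0$, $N\in\mathbb N$ and $2\le p<3$. For an interval $I$, $q>0$ and a two-index map $g=(g_{st})_{s\le t\in I}$ with values in a finite-dimensional normed space, write $\omega_g(J)=\sup\sum_i|g_{t_it_{i+1}}|^q$ for every interval $J\subseteq I$, the supremum being over all finite partitions $t_0<t_1<\dots$ of $J$. Write $g\in V^q_2(I)$ if $\omega_g(I)<\infty$ and $\omega_g([s,t])\to0$ as $|t-s|\to0$ $(s\le t\in I)$; write $g\in V^q_{2,\mathrm{loc}}(I)$ if $I$ is covered by countably many intervals $I_k\subseteq I$ with $g\in V^q_2(I_k)$ for every $k$; and, for a path $g$ with increments $\delta g_{st}=g_t-g_s$, write $g\in V^q_1(I)$ if $\delta g\in V^q_2(I)$. Let $\mathbb X=(\mathbb X^1,\mathbb X^2)\in V^p_2([0,T];\mathbb R^N)\times V^{p/2}_2([0,T];\mathbb R^{N\times N})$ be an $N$-dimensional $p$-variation rough path, not necessarily geometric, that is, for all $0\le s<u<t\le T$ and all $i,j$, $$\mathbb X^{1}_{st}=\mathbb X^1_{su}+\mathbb X^1_{ut},\qquad \mathbb X^{2,ij}_{st}-\mathbb X^{2,ij}_{su}-\mathbb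 X^{2,ij}_{ut}=\mathbb X^{1,i}_{su}\,\mathbb X^{1,j}_{ut}.$$ Let $f\in\mathcal C^3_b(\mathbb R;\mathcal L(\mathbb R^N,\mathbb R))$, that is, $f$ is three times differentiable, and $f$ and its first three derivatives are bounded. Let $f_1,\dots,f_N$ be its components, and set $f_{2,ij}:=f_i\,f_j'$. A solution on $[0,T]$, with initial condition $a$, of the reflected rough differential equation $dy_t=f(y_t)\,d\mathbb X_t+dm_t$, $y_t\,dm_t=0$, is a pair $(y,m)$ with $y\in V^p_1([0,T])$, $y\ge0$, and $m\in V^1_1([0,T])$, $m\ge0$, $m$ nondecreasing, for which there is a map $y^\natural\in V^{p/3}_{2,\mathrm{loc}}([0,T];\mathbb R)$ such that, for all $0\le s\le t\le T$, $$\delta y_{st}=\sum_i f_i(y_s)\,\mathbb X^{1,i}_{st}+\sum_{i,j}f_{2,ij}(y_s)\,\mathbb X^{2,ij}_{st}+\delta m_{st}+y^\natural_{st},$$ $$y_0=a,\qquad m_t=\int_{[0,t]}\mathbf 1_{\{y_u=0\}}\,dm_u,$$ where $dm$ denotes the measure on $[0,T]$ with $dm([0,t])=m_t$ for all $t\in[0,T]$.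 Then there is at most one such solution: if $(y,m)$ and $(z,n)$ are two solutions on $[0,T]$ with initial condition $a$, then $y=z$ and $m=n$ on $[0,T]$. -/

import Mathlib

open scoped ENNReal

noncomputable section

namespace ReflectedRDE

/-- Increments `δg_{st} = g_t - g_s` of a path `g`. -/
def increment {E : Type*} [NormedAddCommGroup E] (g : ℝ → E) (s t : ℝ) : E := g t - g s

/-- The `q`-th power `ω_g(I) = ‖g‖^q` of the `q`-variation norm over `I` of a two-index map `g`:
the supremum of `∑ i, |g_{t_i t_{i+1}}|^q` over all finite strictly increasing families
`t_0 < t_1 < ⋯ < t_n` of points of `I`. (Adding the endpoints of `I` to such a family only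
increases the sum, so this is the supremum over the partitions of `I`.) -/
def variation {E : Type*} [NormedAddCommGroup E] (q : ℝ) (I : Set ℝ) (g : ℝ → ℝ → E) : ℝ≥0∞ :=
  ⨆ (n : ℕ) (t : Fin (n + 1) → ℝ) (_ : StrictMono t) (_ : ∀ i, t i ∈ I),
    ∑ i : Fin n, ‖g (t i.castSucc) (t i.succ)‖ₑ ^ q

/-- `g ∈ V^q_2(I; E)`: finite `q`-variation over `I`, and the control
`ω_g(s,t) = variation q [s,t] g` is regular on `I`, i.e. `ω_g(s,t) → 0` as `|t - s| → 0`. -/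
structure MemV2 {E : Type*} [NormedAddCommGroup E] (q : ℝ) (I : Set ℝ) (g : ℝ → ℝ → E) :
    Prop where
  finite : variation q I g < ∞
  regular : ∀ ε : ℝ, 0 < ε → ∃ η : ℝ, 0 < η ∧ ∀ s ∈ I, ∀ t ∈ I, s ≤ t → t - s < η →
    variation q (Set.Icc s t) g ≤ ENNReal.ofReal ε

/-- `g ∈ V^q_1(I; E)`: the increments of the path `g` belong to `V^q_2(I; E)`. -/
def MemV1 {E : Type*} [NormedAddCommGroup E] (q : ℝ) (I : Set ℝ) (g : ℝ → E) : Prop :=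
  MemV2 q I (increment g)

/-- `g ∈ V^q_{2,loc}(I; E)`: there is a countable covering of `I` by intervals `I_k ⊆ I` with
`g ∈ V^q_2(I_k; E)` for every `k`. -/
def MemV2loc {E : Type*} [NormedAddCommGroup E] (q : ℝ) (I : Set ℝ) (g : ℝ → ℝ → E) : Prop :=
  ∃ J : ℕ → Set ℝ, (∀ k, (J k).OrdConnected) ∧ (∀ k, J k ⊆ I) ∧ I ⊆ ⋃ k, J k ∧
    ∀ k, MemV2 q (J k) g

/-- A continuous `N`-dimensional `p`-variation rough path on `[0,T]`, not necessarily geometric.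
Only the values at `(s,t)` with `0 ≤ s < t ≤ T` matter. -/
structure RoughPath (N : ℕ) (p T : ℝ) where
  /-- first level -/
  X1 : ℝ → ℝ → EuclideanSpace ℝ (Fin N)
  /-- second level -/
  X2 : ℝ → ℝ → EuclideanSpace ℝ (Fin N × Fin N)
  memX1 : MemV2 p (Set.Icc 0 T) X1
  memX2 : MemV2 (p / 2) (Set.Icc 0 T) X2
  /-- the first level consists of the increments of a path -/
  additive : ∀ s u t : ℝ, 0 ≤ s → s < u → u < t → t ≤ T → X1 s t - X1 s u - X1 u t = 0
  /-- Chen's relation -/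
  chen : ∀ s u t : ℝ, 0 ≤ s → s < u → u < t → t ≤ T → ∀ i j : Fin N,
    X2 s t (i, j) - X2 s u (i, j) - X2 u t (i, j) = X1 s u i * X1 u t j

/-- The class `C_b^3`: three times differentiable, bounded with bounded derivatives. -/
structure IsCb3 {F : Type*} [NormedAddCommGroup F] [NormedSpace ℝ F] (f : ℝ → F) : Prop where
  differentiable : ∀ k : ℕ, k < 3 → Differentiable ℝ (iteratedDeriv k f)
  bounded : ∀ k : ℕ, k ≤ 3 → ∃ C : ℝ, ∀ x : ℝ, ‖iteratedDeriv k f x‖ ≤ C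

/-- The `i`-th component `f_i` of `f : ℝ → L(ℝ^N; ℝ)`. -/
def comp {N : ℕ} (f : ℝ → (EuclideanSpace ℝ (Fin N) →L[ℝ] ℝ)) (i : Fin N) (x : ℝ) : ℝ :=
  f x (EuclideanSpace.single i 1)

/-- The coefficient of `X^{2,ij}` in the expansion. With Chen's relation
`δX^{2,ij}_{sut} = X^{1,i}_{su} X^{1,j}_{ut}` (so `X^{2,ij} = ∫ δx^i dx^j` for smooth `x`)
it is `f_i f_j'`: the derivative falls on the component with the outer integrator `dx^j`. -/
def comp2 {N : ℕ} (f : ℝ → (EuclideanSpace ℝ (Fin N) →L[ℝ] ℝ)) (i j : Fin N) (x : ℝ) : ℝ :=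
  comp f i x * deriv (comp f j) x

/-- `(y, m)`, regarded on `[0,T]`, solves `dy = f(y) dX + dm`, `y dm = 0`, `y ≥ 0`, with initial
condition `a`. -/
structure IsSolution {N : ℕ} {p T : ℝ} (f : ℝ → (EuclideanSpace ℝ (Fin N) →L[ℝ] ℝ))
    (X : RoughPath N p T) (a : ℝ) (y m : ℝ → ℝ) : Prop where
  y_mem : MemV1 p (Set.Icc 0 T) y
  y_nonneg : ∀ t ∈ Set.Icc 0 T, 0 ≤ y t
  m_mem : MemV1 1 (Set.Icc 0 T) m
  m_nonneg : ∀ t ∈ Set.Icc 0 T, 0 ≤ m t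
  m_mono : MonotoneOn m (Set.Icc 0 T)
  /-- the local expansion -/
  expansion : ∃ ynat : ℝ → ℝ → ℝ, MemV2loc (p / 3) (Set.Icc 0 T) ynat ∧
    ∀ s t : ℝ, 0 ≤ s → s ≤ t → t ≤ T →
      y t - y s = ∑ i, comp f i (y s) * X.X1 s t i
        + ∑ i, ∑ j, comp2 f i j (y s) * X.X2 s t (i, j) + (m t - m s) + ynat s t
  init : y 0 = a
  /-- `m_t = ∫_{[0,t]} 1_{y_u = 0} dm_u`, where `dm` is the measure with `dm([0,t]) = m_t` -/
  reflection : ∃ μ : MeasureTheory.Measure ℝ,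
    (∀ t ∈ Set.Icc 0 T, μ (Set.Icc 0 t) = ENNReal.ofReal (m t)) ∧
    ∀ t ∈ Set.Icc 0 T, ENNReal.ofReal (m t) =
      ∫⁻ u in Set.Icc 0 t, Set.indicator {u : ℝ | y u = 0} (fun _ => (1 : ℝ≥0∞)) u ∂μ

end ReflectedRDE

end

noncomputable section

namespace ReflectedRDE

open Filter Topology

/-- A regular control on the simplex over `[a, b]`. -/
structure IsControl (a b : ℝ) (κ : ℝ → ℝ → ℝ) : Prop where
  nonneg : ∀ s t, a ≤ s → s ≤ t → t ≤ b → 0 ≤ κ s t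
  superadd : ∀ s u t, a ≤ s → s ≤ u → u ≤ t → t ≤ b → κ s u + κ u t ≤ κ s t
  regular : ∀ ε, 0 < ε → ∃ η, 0 < η ∧
    ∀ s t, a ≤ s → s ≤ t → t ≤ b → t - s < η → κ s t ≤ ε

namespace IsControl

variable {a b : ℝ} {κ ρ : ℝ → ℝ → ℝ}

theorem diag (h : IsControl a b κ) {s : ℝ} (has : a ≤ s) (hsb : s ≤ b) : κ s s = 0 := by
  have h1 := h.superadd s s s has le_rfl le_rfl hsb
  have h2 := h.nonneg s s has le_rfl hsb
  linarith

theorem mono (h : IsControl a b κ) {s s' t' t : ℝ} (has : a ≤ s) (hs : s ≤ s') (hst : s' ≤ t')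
    (ht : t' ≤ t) (htb : t ≤ b) : κ s' t' ≤ κ s t := by
  have h1 := h.superadd s s' t has hs (hst.trans ht) htb
  have h2 := h.superadd s' t' t (has.trans hs) hst ht htb
  have h3 := h.nonneg s s' has hs (by linarith)
  have h4 := h.nonneg t' t (by linarith) ht htb
  linarith

theorem restrict (h : IsControl a b κ) {a' b' : ℝ} (ha : a ≤ a') (hb : b' ≤ b) :
    IsControl a' b' κ where
  nonneg s t h1 h2 h3 := h.nonneg s t (ha.trans h1) h2 (h3.trans hb)
  superadd s u t h1 h2 h3 h4 := h.superadd s u t (ha.trans h1) h2 h3 (h4.trans hb)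
  regular ε hε := by
    obtain ⟨η, hη, H⟩ := h.regular ε hε
    exact ⟨η, hη, fun s t h1 h2 h3 => H s t (ha.trans h1) h2 (h3.trans hb)⟩

theorem add (h : IsControl a b κ) (h' : IsControl a b ρ) :
    IsControl a b (fun s t => κ s t + ρ s t) where
  nonneg s t h1 h2 h3 := add_nonneg (h.nonneg s t h1 h2 h3) (h'.nonneg s t h1 h2 h3)
  superadd s u t h1 h2 h3 h4 := by
    have := h.superadd s u t h1 h2 h3 h4
    have := h'.superadd s u t h1 h2 h3 h4
    linarith
  regular ε hε := by
    obtain ⟨η, hη, H⟩ := h.regular (ε / 2) (by positivity)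
    obtain ⟨η', hη', H'⟩ := h'.regular (ε / 2) (by positivity)
    refine ⟨min η η', lt_min hη hη', fun s t h1 h2 h3 h4 => ?_⟩
    have := H s t h1 h2 h3 (h4.trans_le (min_le_left _ _))
    have := H' s t h1 h2 h3 (h4.trans_le (min_le_right _ _))
    linarith

theorem const_mul (h : IsControl a b κ) {c : ℝ} (hc : 0 ≤ c) :
    IsControl a b (fun s t => c * κ s t) where
  nonneg s t h1 h2 h3 := mul_nonneg hc (h.nonneg s t h1 h2 h3)
  superadd s u t h1 h2 h3 h4 := by
    have := mul_le_mul_of_nonneg_left (h.superadd s u t h1 h2 h3 h4) hc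
    linarith
  regular ε hε := by
    obtain ⟨η, hη, H⟩ := h.regular (ε / (c + 1)) (by positivity)
    refine ⟨η, hη, fun s t h1 h2 h3 h4 => ?_⟩
    have h5 := H s t h1 h2 h3 h4
    rw [le_div_iff₀ (by positivity)] at h5
    have h6 := h.nonneg s t h1 h2 h3
    nlinarith

end IsControl

/-- `v` is the sum of `φ` over the consecutive points of a finite subdivision from `s` to `t`. -/
inductive PartitionSum (φ : ℝ → ℝ → ℝ≥0∞) : ℝ → ℝ → ℝ≥0∞ → Prop
  | nil (s : ℝ) : PartitionSum φ s s 0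
  | cons (s u t : ℝ) (v : ℝ≥0∞) (hsu : s < u) (h : PartitionSum φ u t v) :
      PartitionSum φ s t (φ s u + v)

namespace PartitionSum

variable {φ : ℝ → ℝ → ℝ≥0∞} {s u t : ℝ} {v w : ℝ≥0∞}

theorem append (h : PartitionSum φ s u v) (h' : PartitionSum φ u t w) :
    PartitionSum φ s t (v + w) := by
  induction h with
  | nil s => simpa using h'
  | cons s u' u v hsu _ ih =>
    rw [add_assoc]
    exact cons s u' t _ hsu (ih h')

theorem single (hst : s < t) : PartitionSum φ s t (φ s t) := by
  simpa using cons s t t 0 hst (nil t)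

theorem nonempty (φ : ℝ → ℝ → ℝ≥0∞) (hst : s ≤ t) : {v | PartitionSum φ s t v}.Nonempty := by
  rcases hst.eq_or_lt with rfl | h
  · exact ⟨0, nil s⟩
  · exact ⟨_, single h⟩

theorem exists_family (h : PartitionSum φ s t v) :
    ∃ (n : ℕ) (τ : Fin (n + 1) → ℝ), StrictMono τ ∧ τ 0 = s ∧ τ (Fin.last n) = t ∧
      ∑ i : Fin n, φ (τ i.castSucc) (τ i.succ) = v := by
  induction h with
  | nil s => exact ⟨0, fun _ => s, fun i j hij => by omega, rfl, rfl, by simp⟩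
  | cons s u t v hsu _ ih =>
    obtain ⟨n, τ, h1, h2, h3, h4⟩ := ih
    refine ⟨n + 1, Fin.cons s τ, ?_, by simp, ?_, ?_⟩
    · rw [Fin.strictMono_iff_lt_succ]
      intro i
      refine Fin.cases ?_ (fun j => ?_) i
      · simpa [h2] using hsu
      · rw [← Fin.succ_castSucc, Fin.cons_succ, Fin.cons_succ]
        exact h1 Fin.castSucc_lt_succ
    · rw [← Fin.succ_last, Fin.cons_succ, h3]
    · rw [Fin.sum_univ_succ]
      simp only [Fin.castSucc_zero, Fin.cons_zero, Fin.cons_succ, ← Fin.succ_castSucc, h2, h4]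

theorem le_variation {E : Type*} [NormedAddCommGroup E] {q : ℝ} {g : ℝ → ℝ → E}
    (h : PartitionSum (fun s t => ‖g s t‖ₑ ^ q) s t v) : v ≤ variation q (Set.Icc s t) g := by
  obtain ⟨n, τ, h1, h2, h3, h4⟩ := h.exists_family
  rw [← h4, variation]
  have h5 : ∀ i, τ i ∈ Set.Icc s t := fun i =>
    ⟨h2 ▸ h1.monotone (Fin.zero_le i), h3 ▸ h1.monotone (Fin.le_last i)⟩
  exact le_iSup_of_le n (le_iSup_of_le τ (le_iSup_of_le h1 (le_iSup_of_le h5 le_rfl)))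

end PartitionSum

theorem variation_mono {E : Type*} [NormedAddCommGroup E] (q : ℝ) {I J : Set ℝ} (hIJ : I ⊆ J)
    (g : ℝ → ℝ → E) : variation q I g ≤ variation q J g := by
  unfold variation
  exact iSup_mono fun n => iSup_mono fun τ => iSup_mono fun h =>
    iSup_mono' fun h' => ⟨fun i => hIJ (h' i), le_rfl⟩

/-- The `q`-variation dominates a regular control. -/
theorem MemV2.exists_control {E : Type*} [NormedAddCommGroup E] {q : ℝ} (hq : 0 < q) {I : Set ℝ}
    [hI : I.OrdConnected] {g : ℝ → ℝ → E} (h : MemV2 q I g) {a b : ℝ} (ha : a ∈ I) (hb : b ∈ I) :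
    ∃ κ, IsControl a b κ ∧ ∀ s t, a ≤ s → s < t → t ≤ b → ‖g s t‖ ≤ κ s t ^ (1 / q) := by
  set φ : ℝ → ℝ → ℝ≥0∞ := fun s t => ‖g s t‖ₑ ^ q
  set ω : ℝ → ℝ → ℝ≥0∞ := fun s t => ⨆ v ∈ {v | PartitionSum φ s t v}, v
  have hωle : ∀ s t, ω s t ≤ variation q (Set.Icc s t) g := fun s t =>
    iSup₂_le fun v hv => PartitionSum.le_variation hv
  have hsub : ∀ s t, a ≤ s → t ≤ b → Set.Icc s t ⊆ I := fun s t h1 h2 =>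
    (Set.Icc_subset_Icc h1 h2).trans (hI.out ha hb)
  have hfin : ∀ s t, a ≤ s → t ≤ b → ω s t ≠ ∞ := fun s t h1 h2 =>
    (((hωle s t).trans (variation_mono q (hsub s t h1 h2) g)).trans_lt h.finite).ne
  refine ⟨fun s t => (ω s t).toReal, ⟨fun _ _ _ _ _ => ENNReal.toReal_nonneg, ?_, ?_⟩, ?_⟩
  · intro s u t h1 h2 h3 h4
    rw [← ENNReal.toReal_add (hfin s u h1 (h3.trans h4)) (hfin u t (h1.trans h2) h4)]
    refine ENNReal.toReal_mono (hfin s t h1 h4) ?_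
    refine ENNReal.biSup_add_biSup_le (PartitionSum.nonempty φ h2) (PartitionSum.nonempty φ h3) ?_
    intro v hv w hw
    exact le_iSup₂_of_le (v + w) (PartitionSum.append hv hw) le_rfl
  · intro ε hε
    obtain ⟨η, hη, H⟩ := h.regular ε hε
    refine ⟨η, hη, fun s t h1 h2 h3 h4 => ?_⟩
    have := (hωle s t).trans (H s (hI.out ha hb ⟨h1, h2.trans h3⟩) t
      (hI.out ha hb ⟨h1.trans h2, h3⟩) h2 h4)
    exact ENNReal.toReal_le_of_le_ofReal hε.le this
  · intro s t h1 h2 h3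
    have h4 : φ s t ≤ ω s t := le_iSup₂_of_le (φ s t) (PartitionSum.single h2) le_rfl
    have h5 := ENNReal.toReal_mono (hfin s t h1 h3) h4
    have h6 : (φ s t).toReal = ‖g s t‖ ^ q := by
      simp only [φ]
      rw [← ENNReal.toReal_rpow, toReal_enorm]
    rw [h6] at h5
    calc ‖g s t‖ = (‖g s t‖ ^ q) ^ (1 / q) := by
          rw [← Real.rpow_mul (norm_nonneg _), mul_one_div_cancel hq.ne', Real.rpow_one]
      _ ≤ _ := Real.rpow_le_rpow (by positivity) h5 (by positivity)

/-- One bisection step for an almost additive two-parameter function. -/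
theorem almost_additive_step {a b θ c N K : ℝ} {κ R : ℝ → ℝ → ℝ} (hκ : IsControl a b κ)
    (hθ : 0 < θ) (hc : 0 ≤ c) (hN : 0 ≤ N) (hK : 0 ≤ K)
    (hRK : ∀ s t, a ≤ s → s ≤ t → t ≤ b → |R s t| ≤ K * κ s t ^ θ)
    (hδ : ∀ s u t, a ≤ s → s ≤ u → u ≤ t → t ≤ b →
      |R s t - R s u - R u t| ≤ N * κ s t ^ θ + c * |R s u|) :
    ∀ s t, a ≤ s → s ≤ t → t ≤ b →
      |R s t| ≤ ((1 + c) * 2 ^ (1 - θ) * K + 2 * N) * κ s t ^ θ := by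
  intro s t has hst htb
  have hκ0 := hκ.nonneg s t has hst htb
  -- the points up to which at most half of the control is spent
  set S : Set ℝ := {u | u ∈ Set.Icc s t ∧ κ s u ≤ κ s t / 2}
  have hsS : s ∈ S := ⟨⟨le_rfl, hst⟩, by rw [hκ.diag has (hst.trans htb)]; positivity⟩
  have hSb : BddAbove S := ⟨t, fun u hu => hu.1.2⟩
  set x := sSup S
  have hsx : s ≤ x := le_csSup hSb hsS
  have hxt : x ≤ t := csSup_le ⟨s, hsS⟩ fun u hu => hu.1.2
  have key : ∀ ε, 0 < ε → |R s t| ≤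
      ((1 + c) * 2 ^ (1 - θ) * K + 2 * N) * κ s t ^ θ + (1 + c) * (K * ε ^ θ) := by
    intro ε hε
    obtain ⟨η, hη, H⟩ := hκ.regular ε hε
    obtain ⟨u, hsu, hux, hxu, hu⟩ : ∃ u, s ≤ u ∧ u ≤ x ∧ x - η / 3 ≤ u ∧ κ s u ≤ κ s t / 2 := by
      rcases le_total (x - η / 3) s with h | h
      · exact ⟨s, le_rfl, hsx, h, hsS.2⟩
      · refine ⟨x - η / 3, h, by linarith, le_rfl, ?_⟩
        obtain ⟨v, hv, hv'⟩ := exists_lt_of_lt_csSup ⟨s, hsS⟩ (show x - η / 3 < x by linarith)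
        exact (hκ.mono has le_rfl h hv'.le (hv.1.2.trans htb)).trans hv.2
    obtain ⟨v, hvt, hxv, hvx, hv⟩ : ∃ v, v ≤ t ∧ x ≤ v ∧ v ≤ x + η / 3 ∧ κ v t ≤ κ s t / 2 := by
      rcases le_total t (x + η / 3) with h | h
      · exact ⟨t, le_rfl, hxt, h, by rw [hκ.diag (has.trans hst) htb]; positivity⟩
      · refine ⟨x + η / 3, h, by linarith, le_rfl, ?_⟩
        have h1 : x + η / 3 ∉ S := fun h' => by linarith [le_csSup hSb h']
        have h2 : κ s t / 2 < κ s (x + η / 3) := by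
          by_contra h'
          exact h1 ⟨⟨by linarith, h⟩, not_lt.mp h'⟩
        linarith [hκ.superadd s (x + η / 3) t has (by linarith) h htb]
    have huv : u ≤ v := hux.trans hxv
    have hε' := H u v (has.trans hsu) huv (hvt.trans htb) (by linarith)
    have hhalf : ∀ y, 0 ≤ y → y ≤ κ s t / 2 → K * y ^ θ ≤ 2 ^ (-θ) * K * κ s t ^ θ := by
      intro y hy0 hy
      have h1 : y ^ θ ≤ (κ s t / 2) ^ θ := Real.rpow_le_rpow hy0 hy hθ.le
      rw [Real.div_rpow hκ0 (by norm_num), div_eq_mul_inv, ← Real.rpow_neg (by norm_num)] at h1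
      nlinarith [mul_le_mul_of_nonneg_left h1 hK]
    have e1 := (hRK s u has hsu (by linarith)).trans
      (hhalf _ (hκ.nonneg s u has hsu (by linarith)) hu)
    have e2 := (hRK v t (by linarith) hvt htb).trans
      (hhalf _ (hκ.nonneg v t (by linarith) hvt htb) hv)
    have e3 : |R u v| ≤ K * ε ^ θ := (hRK u v (by linarith) huv (by linarith)).trans
      (mul_le_mul_of_nonneg_left (Real.rpow_le_rpow
        (hκ.nonneg u v (by linarith) huv (by linarith)) hε' hθ.le) hK)
    have d1 := hδ s u t has hsu (by linarith) htb
    have d2 := hδ u v t (by linarith) huv hvt htb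
    have m1 : N * κ u t ^ θ ≤ N * κ s t ^ θ := mul_le_mul_of_nonneg_left (Real.rpow_le_rpow
      (hκ.nonneg u t (by linarith) (by linarith) htb)
      (hκ.mono has hsu (by linarith) le_rfl htb) hθ.le) hN
    have h2 : (2 : ℝ) ^ (1 - θ) = 2 * 2 ^ (-θ) := by
      rw [sub_eq_add_neg, Real.rpow_add (by norm_num), Real.rpow_one]
    have tri : |R s t| ≤ |R s t - R s u - R u t| + |R u t - R u v - R v t|
        + |R s u| + |R u v| + |R v t| := by
      have : R s t = (R s t - R s u - R u t) + (R u t - R u v - R v t)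
        + R s u + R u v + R v t := by ring
      calc |R s t| = |(R s t - R s u - R u t) + (R u t - R u v - R v t)
            + R s u + R u v + R v t| := by rw [← this]
        _ ≤ _ := by
          refine (abs_add_le _ _).trans (add_le_add_left ((abs_add_le _ _).trans
            (add_le_add_left ((abs_add_le _ _).trans (add_le_add_left (abs_add_le _ _) _)) _)) _)
    rw [h2]
    set A := 2 ^ (-θ) * K * κ s t ^ θ
    have hA : 0 ≤ A := by positivity
    have c1 := mul_le_mul_of_nonneg_left e1 hc
    have c3 := mul_le_mul_of_nonneg_left e3 hc
    have hcA := mul_nonneg hc hA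
    calc |R s t| ≤ 2 * (N * κ s t ^ θ) + (1 + c) * A + A + (1 + c) * (K * ε ^ θ) := by linarith
      _ ≤ 2 * (N * κ s t ^ θ) + (1 + c) * (2 * A) + (1 + c) * (K * ε ^ θ) := by linarith
      _ = _ := by simp only [A]; ring
  have hlim : Tendsto (fun ε : ℝ => ((1 + c) * 2 ^ (1 - θ) * K + 2 * N) * κ s t ^ θ
      + (1 + c) * (K * ε ^ θ)) (𝓝[>] 0)
      (𝓝 (((1 + c) * 2 ^ (1 - θ) * K + 2 * N) * κ s t ^ θ + (1 + c) * (K * (0 : ℝ) ^ θ))) := by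
    refine Tendsto.mono_left ?_ nhdsWithin_le_nhds
    have := (Real.continuous_rpow_const hθ.le).tendsto (0 : ℝ)
    exact (this.const_mul K).const_mul (1 + c) |>.const_add _
  rw [Real.zero_rpow hθ.ne', mul_zero, mul_zero, add_zero] at hlim
  exact ge_of_tendsto hlim (eventually_mem_nhdsWithin.mono fun ε hε => key ε hε)

/-- Sewing estimate for almost additive functions, with absorption of the linear term. -/
theorem abs_le_of_almost_additive {a b θ c N : ℝ} {κ ρ R : ℝ → ℝ → ℝ} (hκ : IsControl a b κ)
    (hρ : IsControl a b ρ) (hθ : 0 < θ) (hc : 0 ≤ c) (hN : 0 ≤ N)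
    (hlam : (1 + c) * 2 ^ (1 - θ) < 1)
    (hRρ : ∀ s t, a ≤ s → s ≤ t → t ≤ b → |R s t| ≤ ρ s t ^ θ)
    (hδ : ∀ s u t, a ≤ s → s ≤ u → u ≤ t → t ≤ b →
      |R s t - R s u - R u t| ≤ N * κ s t ^ θ + c * |R s u|) :
    ∀ s t, a ≤ s → s ≤ t → t ≤ b →
      |R s t| ≤ 2 * N / (1 - (1 + c) * 2 ^ (1 - θ)) * κ s t ^ θ := by
  set lam := (1 + c) * (2 : ℝ) ^ (1 - θ)
  have hlam0 : 0 ≤ lam := by positivity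
  have hlam1 : 0 < 1 - lam := by linarith
  set C := 2 * N / (1 - lam)
  have hC0 : 0 ≤ C := by positivity
  have hC : lam * C + 2 * N = C := by
    simp only [C]; field_simp; ring
  have key : ∀ ε, 0 < ε → ∀ s t, a ≤ s → s ≤ t → t ≤ b →
      |R s t| ≤ C * (κ s t + ε * ρ s t) ^ θ := by
    intro ε hε
    have hκ' := hκ.add (hρ.const_mul hε.le)
    have iter : ∀ n : ℕ, ∀ s t, a ≤ s → s ≤ t → t ≤ b →
        |R s t| ≤ (lam ^ n * (ε⁻¹) ^ θ + C) * (κ s t + ε * ρ s t) ^ θ := by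
      intro n
      induction n with
      | zero =>
        intro s t h1 h2 h3
        have p1 := hκ.nonneg s t h1 h2 h3
        have p2 := hρ.nonneg s t h1 h2 h3
        have p3 := hκ'.nonneg s t h1 h2 h3
        have e : ρ s t ^ θ ≤ (ε⁻¹) ^ θ * (κ s t + ε * ρ s t) ^ θ := by
          rw [← Real.mul_rpow (by positivity) p3]
          refine Real.rpow_le_rpow p2 ?_ hθ.le
          rw [mul_add, ← mul_assoc, inv_mul_cancel₀ hε.ne', one_mul]
          have : 0 ≤ ε⁻¹ * κ s t := by positivity
          linarith
        have p4 : 0 ≤ C * (κ s t + ε * ρ s t) ^ θ := by positivity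
        have := hRρ s t h1 h2 h3
        rw [pow_zero, one_mul, add_mul]
        linarith
      | succ n ih =>
        intro s t h1 h2 h3
        have := almost_additive_step hκ' hθ hc hN (K := lam ^ n * (ε⁻¹) ^ θ + C) (by positivity)
          ih (fun s u t h1 h2 h3 h4 => (hδ s u t h1 h2 h3 h4).trans ?_) s t h1 h2 h3
        · refine this.trans_eq ?_
          congr 1
          rw [mul_add, add_assoc, hC, pow_succ]
          ring
        · have p1 := hκ.nonneg s t h1 (h2.trans h3) h4
          have p2 := mul_nonneg hε.le (hρ.nonneg s t h1 (h2.trans h3) h4)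
          gcongr
          linarith
    intro s t h1 h2 h3
    have hlim : Tendsto (fun n : ℕ => (lam ^ n * (ε⁻¹) ^ θ + C) * (κ s t + ε * ρ s t) ^ θ) atTop
        (𝓝 ((0 * (ε⁻¹) ^ θ + C) * (κ s t + ε * ρ s t) ^ θ)) :=
      (((tendsto_pow_atTop_nhds_zero_of_lt_one hlam0 hlam).mul_const _).add_const C).mul_const _
    rw [zero_mul, zero_add] at hlim
    exact ge_of_tendsto' hlim fun n => iter n s t h1 h2 h3
  intro s t h1 h2 h3
  have hlim : Tendsto (fun ε : ℝ => C * (κ s t + ε * ρ s t) ^ θ) (𝓝[>] 0)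
      (𝓝 (C * (κ s t + 0 * ρ s t) ^ θ)) := by
    refine Tendsto.mono_left ?_ nhdsWithin_le_nhds
    have : Continuous fun ε : ℝ => C * (κ s t + ε * ρ s t) ^ θ :=
      continuous_const.mul ((Real.continuous_rpow_const hθ.le).comp (by fun_prop))
    exact this.tendsto 0
  rw [zero_mul, add_zero] at hlim
  exact ge_of_tendsto hlim (eventually_mem_nhdsWithin.mono fun ε hε => key ε hε s t h1 h2 h3)

/-- `|R| ≤ C ω^θ` on the simplex over `[a, b]`. -/
def BoundedOn (R ω : ℝ → ℝ → ℝ) (θ C a b : ℝ) : Prop :=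
  ∀ s t, a ≤ s → s ≤ t → t ≤ b → |R s t| ≤ C * ω s t ^ θ

/-- A two-parameter function whose defect of additivity is controlled by `ω` and by itself. -/
structure IsAlmostAdditive (T θ α L : ℝ) (ω R : ℝ → ℝ → ℝ) : Prop where
  control : IsControl 0 T ω
  one_lt : 1 < θ
  pos : 0 < α
  nonneg : 0 ≤ L
  diag : ∀ s, R s s = 0
  crude : ∀ s t, 0 ≤ s → s ≤ t → t ≤ T → |R s t| ≤ L * ω s t ^ α
  defect : ∀ s u t, 0 ≤ s → s ≤ u → u ≤ t → t ≤ T →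
    |R s t - R s u - R u t| ≤ L * ω s t ^ θ + L * ω s t ^ α * |R s u|

theorem exists_absorption_const {θ : ℝ} (hθ : 1 < θ) :
    ∃ c : ℝ, 0 < c ∧ (1 + c) * 2 ^ (1 - θ) < 1 := by
  have h0 : (2 : ℝ) ^ (1 - θ) < 1 := Real.rpow_lt_one_of_one_lt_of_neg (by norm_num) (by linarith)
  have h1 : (0 : ℝ) < 2 ^ (1 - θ) := by positivity
  refine ⟨((2 : ℝ) ^ (1 - θ))⁻¹ / 2 - 1 / 2, ?_, ?_⟩
  · have := (one_lt_inv₀ h1).mpr h0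
    linarith
  · have : (1 + (((2 : ℝ) ^ (1 - θ))⁻¹ / 2 - 1 / 2)) * 2 ^ (1 - θ) = 1 / 2 + 2 ^ (1 - θ) / 2 := by
      field_simp; ring
    linarith

theorem exists_rpow_le {α ε : ℝ} (hα : 0 < α) (hε : 0 < ε) :
    ∃ η, 0 < η ∧ ∀ x : ℝ, 0 ≤ x → x ≤ η → x ^ α ≤ ε :=
  ⟨ε ^ (1 / α), by positivity, fun x hx hxη => by
    calc x ^ α ≤ (ε ^ (1 / α)) ^ α := Real.rpow_le_rpow hx hxη hα.le
      _ = ε := by rw [← Real.rpow_mul hε.le, one_div_mul_cancel hα.ne', Real.rpow_one]⟩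

theorem rpow_one_div_mul_rpow {θ C x : ℝ} (hθ : θ ≠ 0) (hC : 0 ≤ C) (hx : 0 ≤ x) :
    (C ^ (1 / θ) * x) ^ θ = C * x ^ θ := by
  rw [Real.mul_rpow (by positivity) hx, ← Real.rpow_mul hC, one_div_mul_cancel hθ, Real.rpow_one]

namespace IsAlmostAdditive

variable {T θ α L : ℝ} {ω R : ℝ → ℝ → ℝ}

theorem boundedOn_self (h : IsAlmostAdditive T θ α L ω R) (C x : ℝ) (hx0 : 0 ≤ x) (hxT : x ≤ T) :
    BoundedOn R ω θ C x x := by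
  intro s t h1 h2 h3
  obtain rfl : s = x := by linarith
  obtain rfl : t = s := by linarith
  rw [h.diag, h.control.diag hx0 hxT, Real.zero_rpow (by linarith [h.one_lt])]
  simp

/-- On intervals of small control, a qualitative bound improves to a bound with a universal
constant. -/
theorem exists_uniform (h : IsAlmostAdditive T θ α L ω R) :
    ∃ η C : ℝ, 0 < η ∧ 0 ≤ C ∧ ∀ a b, 0 ≤ a → a ≤ b → b ≤ T → ω a b ≤ η → ∀ ρ : ℝ → ℝ → ℝ,
      IsControl a b ρ → (∀ s t, a ≤ s → s ≤ t → t ≤ b → |R s t| ≤ ρ s t ^ θ) →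
      BoundedOn R ω θ C a b := by
  obtain ⟨c, hc, hlam⟩ := exists_absorption_const h.one_lt
  have hL := h.nonneg
  obtain ⟨η, hη, H⟩ := exists_rpow_le h.pos (show 0 < c / (L + 1) by positivity)
  refine ⟨η, 2 * L / (1 - (1 + c) * 2 ^ (1 - θ)), hη,
    div_nonneg (by positivity) (by linarith), fun a b ha hab hb hω ρ hρ hR => ?_⟩
  refine abs_le_of_almost_additive (h.control.restrict ha hb) hρ (by linarith [h.one_lt]) hc.le hL
    hlam hR fun s u t h1 h2 h3 h4 => ?_
  refine (h.defect s u t (ha.trans h1) h2 h3 (h4.trans hb)).trans ?_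
  have h5 := H (ω s t) (h.control.nonneg s t (by linarith) (by linarith) (by linarith))
    ((h.control.mono ha h1 (h2.trans h3) h4 hb).trans hω)
  rw [le_div_iff₀ (by positivity)] at h5
  have h6 := Real.rpow_nonneg
    (h.control.nonneg s t (by linarith) (by linarith) (by linarith)) α
  gcongr
  linarith

theorem exists_uniform' (h : IsAlmostAdditive T θ α L ω R) :
    ∃ η C : ℝ, 0 < η ∧ 0 ≤ C ∧ (∀ a b, 0 ≤ a → a ≤ b → b ≤ T → ω a b ≤ η →
      (∃ ρ : ℝ → ℝ → ℝ, IsControl a b ρ ∧ ∀ s t, a ≤ s → s ≤ t → t ≤ b → |R s t| ≤ ρ s t ^ θ) →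
      BoundedOn R ω θ C a b) ∧ ∀ a b, 0 ≤ a → a ≤ b → b ≤ T → ω a b ≤ η →
      (∃ C', 0 ≤ C' ∧ BoundedOn R ω θ C' a b) → BoundedOn R ω θ C a b := by
  obtain ⟨η, C, hη, hC, H⟩ := h.exists_uniform
  refine ⟨η, C, hη, hC, fun a b h1 h2 h3 h4 ⟨ρ, hρ, h5⟩ => H a b h1 h2 h3 h4 ρ hρ h5, ?_⟩
  rintro a b h1 h2 h3 h4 ⟨C', hC', h5⟩
  refine H a b h1 h2 h3 h4 (fun s t => C' ^ (1 / θ) * ω s t)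
    ((h.control.restrict h1 h3).const_mul (by positivity)) fun s t h6 h7 h8 => ?_
  have h9 := h.control.nonneg s t (by linarith) h7 (by linarith)
  rw [rpow_one_div_mul_rpow (by linarith [h.one_lt]) hC' h9]
  exact h5 s t h6 h7 h8

theorem glue (h : IsAlmostAdditive T θ α L ω R) {a b c : ℝ} (ha : 0 ≤ a) (hab : a ≤ b)
    (hbc : b ≤ c) (hc : c ≤ T) (h1 : ∃ C, 0 ≤ C ∧ BoundedOn R ω θ C a b)
    (h2 : ∃ C, 0 ≤ C ∧ BoundedOn R ω θ C b c) : ∃ C, 0 ≤ C ∧ BoundedOn R ω θ C a c := by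
  obtain ⟨C₁, hC₁, h1⟩ := h1
  obtain ⟨C₂, hC₂, h2⟩ := h2
  have hL := h.nonneg
  have hθ := h.one_lt
  have hωT := h.control.nonneg 0 T le_rfl (by linarith) le_rfl
  have hD : 0 ≤ L * ω 0 T ^ α * C₁ := by positivity
  refine ⟨C₁ + C₂ + L + L * ω 0 T ^ α * C₁, by positivity, fun s t hs hst ht => ?_⟩
  have h0 := h.control.nonneg s t (by linarith) hst (by linarith)
  have hp := Real.rpow_nonneg h0 θ
  have hle : ∀ s' t', s ≤ s' → s' ≤ t' → t' ≤ t → ω s' t' ^ θ ≤ ω s t ^ θ := fun s' t' e1 e2 e3 =>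
    Real.rpow_le_rpow (h.control.nonneg s' t' (by linarith) e2 (by linarith))
      (h.control.mono (by linarith) e1 e2 e3 (by linarith)) (by linarith)
  rcases le_total t b with htb | htb
  · refine (h1 s t hs hst htb).trans ?_
    gcongr
    linarith
  rcases le_total b s with hbs | hbs
  · refine (h2 s t hbs hst ht).trans ?_
    gcongr
    linarith
  have e1 := h1 s b hs hbs le_rfl
  have e2 := h2 b t le_rfl htb ht
  have e3 := h.defect s b t (by linarith) hbs htb (by linarith)
  have e4 := mul_le_mul_of_nonneg_left (hle s b le_rfl hbs htb) hC₁
  have e5 := mul_le_mul_of_nonneg_left (hle b t hbs htb le_rfl) hC₂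
  have e6 : L * ω s t ^ α * |R s b| ≤ L * ω 0 T ^ α * (C₁ * ω s t ^ θ) := by
    gcongr
    · exact h.pos.le
    · exact h.control.mono le_rfl (by linarith) hst (by linarith) le_rfl
    · exact e1.trans e4
  have tri : |R s t| ≤ |R s t - R s b - R b t| + |R s b| + |R b t| := by
    have := abs_add_three (R s t - R s b - R b t) (R s b) (R b t)
    rwa [show R s t - R s b - R b t + R s b + R b t = R s t by ring] at this
  calc |R s t| ≤ C₁ * ω s t ^ θ + C₂ * ω s t ^ θ + L * ω s t ^ θ
        + L * ω 0 T ^ α * (C₁ * ω s t ^ θ) := by linarith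
    _ = _ := by ring

theorem exists_small (h : IsAlmostAdditive T θ α L ω R) {a b ε : ℝ} (ha : 0 ≤ a) (hab : a < b)
    (hb : b ≤ T) (hε : 0 < ε) :
    (∃ s, a < s ∧ s < b ∧ |R a s| ≤ ε) ∧ ∃ s, a < s ∧ s < b ∧ |R s b| ≤ ε := by
  have hL := h.nonneg
  obtain ⟨η, hη, H⟩ := exists_rpow_le h.pos (show 0 < ε / (L + 1) by positivity)
  obtain ⟨δ, hδ, H'⟩ := h.control.regular η hη
  have key : ∀ s t, a ≤ s → s ≤ t → t ≤ b → t - s < δ → |R s t| ≤ ε := by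
    intro s t h1 h2 h3 h4
    refine (h.crude s t (by linarith) h2 (by linarith)).trans ?_
    have h5 := H _ (h.control.nonneg s t (by linarith) h2 (by linarith))
      (H' s t (by linarith) h2 (by linarith) h4)
    rw [le_div_iff₀ (by positivity)] at h5
    have := Real.rpow_nonneg (h.control.nonneg s t (by linarith) h2 (by linarith)) α
    linarith
  have hm : 0 < min (δ / 2) ((b - a) / 2) := lt_min (by linarith) (by linarith)
  have hm1 := min_le_left (δ / 2) ((b - a) / 2)
  have hm2 := min_le_right (δ / 2) ((b - a) / 2)
  exact ⟨⟨a + min (δ / 2) ((b - a) / 2), by linarith, by linarith,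
      key _ _ le_rfl (by linarith) (by linarith) (by linarith)⟩,
    ⟨b - min (δ / 2) ((b - a) / 2), by linarith, by linarith,
      key _ _ (by linarith) (by linarith) le_rfl (by linarith)⟩⟩

theorem boundedOn_of_left {C a b : ℝ} (h : IsAlmostAdditive T θ α L ω R) (hC : 0 ≤ C)
    (ha : 0 ≤ a) (hb : b ≤ T) (H : ∀ s, a < s → s ≤ b → BoundedOn R ω θ C s b) :
    ∃ C, 0 ≤ C ∧ BoundedOn R ω θ C a b := by
  have hL := h.nonneg
  have hθ := h.one_lt
  refine ⟨C + L, by positivity, fun s t hs hst ht => ?_⟩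
  have h0 := h.control.nonneg s t (by linarith) hst (by linarith)
  have hp := Real.rpow_nonneg h0 θ
  rcases hs.lt_or_eq with hs | rfl
  · refine (H s hs (hst.trans ht) s t le_rfl hst ht).trans ?_
    gcongr
    linarith
  rcases hst.eq_or_lt with rfl | hst
  · rw [h.diag, abs_zero]
    positivity
  set D := L * ω a t ^ α
  have hD : 0 ≤ D := by positivity
  refine le_of_forall_pos_le_add fun ε hε => ?_
  obtain ⟨u, hu, hut, hR⟩ := (h.exists_small ha hst (ht.trans hb) (ε := ε / (1 + D))
    (by positivity)).1
  rw [le_div_iff₀ (by positivity)] at hR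
  have e2 := H u hu (hut.le.trans ht) u t le_rfl hut.le ht
  have e3 := h.defect a u t ha hu.le hut.le (ht.trans hb)
  have e5 : C * ω u t ^ θ ≤ C * ω a t ^ θ := mul_le_mul_of_nonneg_left
    (Real.rpow_le_rpow (h.control.nonneg u t (by linarith) hut.le (by linarith))
      (h.control.mono ha hu.le hut.le le_rfl (by linarith)) (by linarith)) hC
  have tri : |R a t| ≤ |R a t - R a u - R u t| + |R a u| + |R u t| := by
    have := abs_add_three (R a t - R a u - R u t) (R a u) (R u t)
    rwa [show R a t - R a u - R u t + R a u + R u t = R a t by ring] at this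
  change _ ≤ L * ω a t ^ θ + D * _ at e3
  linarith

theorem boundedOn_of_right {C a b : ℝ} (h : IsAlmostAdditive T θ α L ω R) (hC : 0 ≤ C)
    (ha : 0 ≤ a) (hb : b ≤ T) (H : ∀ t, a ≤ t → t < b → BoundedOn R ω θ C a t) :
    ∃ C, 0 ≤ C ∧ BoundedOn R ω θ C a b := by
  have hL := h.nonneg
  have hθ := h.one_lt
  rcases lt_or_ge b a with hba | hab
  · exact ⟨0, le_rfl, fun s t h1 h2 h3 => by linarith⟩
  have hωab := h.control.nonneg a b ha hab hb
  set D := L * ω a b ^ α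
  have hD : 0 ≤ D := by positivity
  refine ⟨C + L + D * C, by positivity, fun s t hs hst ht => ?_⟩
  have h0 := h.control.nonneg s t (by linarith) hst (by linarith)
  have hp := Real.rpow_nonneg h0 θ
  rcases ht.lt_or_eq with ht | rfl
  · refine (H t (hs.trans hst) ht s t hs hst le_rfl).trans ?_
    gcongr
    have : 0 ≤ D * C := by positivity
    linarith
  rcases hst.eq_or_lt with rfl | hst
  · rw [h.diag, abs_zero]
    positivity
  refine le_of_forall_pos_le_add fun ε hε => ?_
  obtain ⟨u, hu, hut, hR⟩ := (h.exists_small (ha.trans hs) hst hb hε).2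
  have e2 := H u (hs.trans hu.le) hut s u hs hu.le le_rfl
  have e3 := h.defect s u t (by linarith) hu.le hut.le hb
  have e5 : C * ω s u ^ θ ≤ C * ω s t ^ θ := mul_le_mul_of_nonneg_left
    (Real.rpow_le_rpow (h.control.nonneg s u (by linarith) hu.le (by linarith))
      (h.control.mono (by linarith) le_rfl hu.le hut.le (by linarith)) (by linarith)) hC
  have e6 : L * ω s t ^ α * |R s u| ≤ D * (C * ω s t ^ θ) := by
    simp only [D]
    gcongr
    · exact h.pos.le
    · exact h.control.mono ha hs hst.le le_rfl hb
    · exact e2.trans e5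
  have tri : |R s t| ≤ |R s t - R s u - R u t| + |R s u| + |R u t| := by
    have := abs_add_three (R s t - R s u - R u t) (R s u) (R u t)
    rwa [show R s t - R s u - R u t + R s u + R u t = R s t by ring] at this
  calc |R s t| ≤ C * ω s t ^ θ + L * ω s t ^ θ + D * (C * ω s t ^ θ) + ε := by linarith
    _ = _ := by ring

/-- The point `x` has a neighbourhood on which `R` is bounded by a multiple of `ω^θ`. -/
def IsGood (T θ : ℝ) (ω R : ℝ → ℝ → ℝ) (x : ℝ) : Prop :=
  ∃ ε, 0 < ε ∧ ∃ C, 0 ≤ C ∧ BoundedOn R ω θ C (max 0 (x - ε)) (min T (x + ε))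

theorem isOpen_isGood (T θ : ℝ) (ω R : ℝ → ℝ → ℝ) : IsOpen {x | IsGood T θ ω R x} := by
  rw [Metric.isOpen_iff]
  rintro x ⟨ε, hε, C, hC, H⟩
  refine ⟨ε / 2, by positivity, fun y hy => ⟨ε / 2, by positivity, C, hC, ?_⟩⟩
  rw [Metric.mem_ball, Real.dist_eq, abs_lt] at hy
  intro s t h1 h2 h3
  rw [max_le_iff] at h1
  rw [le_min_iff] at h3
  exact H s t (max_le h1.1 (by linarith)) h2 (le_min h3.1 (by linarith))

theorem boundedOn_of_forall_isGood (h : IsAlmostAdditive T θ α L ω R) {a b : ℝ} (ha : 0 ≤ a)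
    (hab : a ≤ b) (hb : b ≤ T) (H : ∀ x, a ≤ x → x ≤ b → IsGood T θ ω R x) :
    ∃ C, 0 ≤ C ∧ BoundedOn R ω θ C a b := by
  choose! ε hε C hC hR using H
  obtain ⟨t, ht0, htm, ⟨m, hm⟩, ht⟩ := exists_monotone_Icc_subset_open_cover_Icc hab
    (c := fun x : Set.Icc a b => {y : Set.Icc a b | |(y : ℝ) - x| < ε x})
    (fun x => isOpen_lt (by fun_prop) continuous_const)
    (fun x _ => Set.mem_iUnion.mpr ⟨x, by simpa using hε x x.2.1 x.2.2⟩)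
  have key : ∀ n, ∃ C, 0 ≤ C ∧ BoundedOn R ω θ C a (t n) := by
    intro n
    induction n with
    | zero =>
      rw [ht0]
      exact ⟨0, le_rfl, h.boundedOn_self _ _ ha (hab.trans hb)⟩
    | succ n ih =>
      have hle : (t n : ℝ) ≤ t (n + 1) := htm n.le_succ
      refine h.glue ha (t n).2.1 hle ((t (n + 1)).2.2.trans hb) ih ?_
      obtain ⟨x, hx⟩ := ht n
      refine ⟨C x, hC x x.2.1 x.2.2, fun s r h1 h2 h3 => hR x x.2.1 x.2.2 s r ?_ h2 ?_⟩
      · have : |(t n : ℝ) - x| < ε x := hx (Set.left_mem_Icc.mpr (htm n.le_succ))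
        have := abs_lt.mp this
        exact max_le (by linarith [(t n).2.1]) (by linarith)
      · have : |(t (n + 1) : ℝ) - x| < ε x := hx (Set.right_mem_Icc.mpr (htm n.le_succ))
        have := abs_lt.mp this
        exact le_min (by linarith [(t (n + 1)).2.2]) (by linarith)
  have := key m
  rwa [hm m le_rfl] at this

/-- If all points near `x`, other than `x`, are good, then so is `x`. -/
theorem isGood_of_punctured (h : IsAlmostAdditive T θ α L ω R) {x : ℝ} (hx0 : 0 ≤ x) (hxT : x ≤ T)
    {r : ℝ} (hr : 0 < r)
    (H : ∀ y, 0 ≤ y → y ≤ T → y ≠ x → |y - x| < r → IsGood T θ ω R y) : IsGood T θ ω R x := by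
  obtain ⟨η, C, hη, hC, -, hU⟩ := h.exists_uniform'
  obtain ⟨δ, hδ, hω⟩ := h.control.regular η hη
  set ε := min r δ / 2
  have hε : 0 < ε := half_pos (lt_min hr hδ)
  have hεr : ε < r := by
    have := min_le_left r δ
    simp only [ε]; linarith
  have hεδ : ε < δ := by
    have := min_le_right r δ
    simp only [ε]; linarith
  refine ⟨ε, hε, h.glue (le_max_left _ _) (max_le hx0 (by linarith)) (le_min hxT (by linarith))
    (min_le_left _ _) ?_ ?_⟩
  · have g1 := le_max_left 0 (x - ε)
    have g2 := le_max_right 0 (x - ε)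
    refine h.boundedOn_of_right hC g1 hxT fun t h1 h2 => hU _ _ g1 h1 (by linarith)
      (hω _ _ g1 h1 (by linarith) (by linarith)) ?_
    refine h.boundedOn_of_forall_isGood g1 h1 (by linarith) fun y h3 h4 =>
      H y (by linarith) (by linarith) (by linarith : y < x).ne ?_
    rw [abs_lt]
    constructor <;> linarith
  · have g1 := min_le_left T (x + ε)
    have g2 := min_le_right T (x + ε)
    refine h.boundedOn_of_left hC hx0 g1 fun s h1 h2 => hU _ _ (by linarith) h2 g1
      (hω _ _ (by linarith) h2 g1 (by linarith)) ?_
    refine h.boundedOn_of_forall_isGood (by linarith) h2 g1 fun y h3 h4 =>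
      H y (by linarith) (by linarith) (by linarith : x < y).ne' ?_
    rw [abs_lt]
    constructor <;> linarith

/-- A countable covering by intervals on which `R` has finite regular variation suffices for a
global bound: the set of bad points is closed, countable and has no isolated point. -/
theorem boundedOn_of_locally (h : IsAlmostAdditive T θ α L ω R) (hT : 0 ≤ T) (J : ℕ → Set ℝ)
    (hJ : ∀ x, 0 ≤ x → x ≤ T → ∃ k, x ∈ J k)
    (hloc : ∀ k, ∀ a ∈ J k, ∀ b ∈ J k, a ≤ b → ∃ ρ : ℝ → ℝ → ℝ, IsControl a b ρ ∧
      ∀ s t, a ≤ s → s ≤ t → t ≤ b → |R s t| ≤ ρ s t ^ θ) :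
    ∃ C, 0 ≤ C ∧ BoundedOn R ω θ C 0 T := by
  obtain ⟨η, C, hη, hC, hU, -⟩ := h.exists_uniform'
  set F : Set ℝ := Set.Icc 0 T ∩ {x | IsGood T θ ω R x}ᶜ
  have hclosed : IsClosed F := isClosed_Icc.inter (isOpen_isGood T θ ω R).isClosed_compl
  have hcount : F.Countable := by
    refine ((Set.countable_range fun k => sInf (J k)).union
      (Set.countable_range fun k => sSup (J k))).mono ?_
    rintro x ⟨⟨hx0, hxT⟩, hbad⟩
    obtain ⟨k, hk⟩ := hJ x hx0 hxT
    by_contra hcon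
    rw [Set.mem_union, not_or] at hcon
    have h1 : ∃ a ∈ J k, a < x := by
      by_contra! hno
      exact hcon.1 ⟨k, IsLeast.csInf_eq ⟨hk, hno⟩⟩
    have h2 : ∃ b ∈ J k, x < b := by
      by_contra! hno
      exact hcon.2 ⟨k, IsGreatest.csSup_eq ⟨hk, hno⟩⟩
    obtain ⟨a, ha, hax⟩ := h1
    obtain ⟨b, hb, hxb⟩ := h2
    obtain ⟨ρ, hρ, hR⟩ := hloc k a ha b hb (by linarith)
    obtain ⟨δ, hδ, hω⟩ := h.control.regular η hη
    obtain ⟨ε, hε, hεm⟩ := exists_between (lt_min (half_pos hδ)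
      (lt_min (sub_pos.mpr hax) (sub_pos.mpr hxb)))
    rw [lt_min_iff, lt_min_iff] at hεm
    have g1 := le_max_left 0 (x - ε)
    have g2 := le_max_right 0 (x - ε)
    have g3 := min_le_left T (x + ε)
    have g4 := min_le_right T (x + ε)
    have g5 : max 0 (x - ε) ≤ min T (x + ε) := max_le (le_min hT (by linarith))
      (le_min (by linarith) (by linarith))
    exact hbad ⟨ε, hε, C, hC, hU _ _ g1 g5 g3 (hω _ _ g1 g5 g3 (by linarith)) ⟨ρ,
      hρ.restrict (by linarith) (by linarith), fun s t h1 h2 h3 =>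
        hR s t (by linarith) h2 (by linarith)⟩⟩
  have hperf : Preperfect F := by
    intro x hx
    by_contra hacc
    rw [accPt_iff_nhds] at hacc
    push Not at hacc
    obtain ⟨U, hU, hUF⟩ := hacc
    obtain ⟨r, hr, hrU⟩ := Metric.mem_nhds_iff.mp hU
    refine hx.2 (h.isGood_of_punctured hx.1.1 hx.1.2 hr fun y h0 h1 h2 h3 => ?_)
    by_contra hbad
    exact h2 (hUF y ⟨hrU (by rwa [Metric.mem_ball, Real.dist_eq]), ⟨h0, h1⟩, hbad⟩)
  have hempty : F = ∅ := by
    by_contra hne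
    obtain ⟨g, hg, -, hginj⟩ := Perfect.exists_nat_bool_injection ⟨hclosed, hperf⟩
      (Set.nonempty_iff_ne_empty.mpr hne)
    have h1 : (Set.range g).Countable := hcount.mono hg
    have h4 : Cardinal.mk (ℕ → Bool) = 2 ^ Cardinal.aleph0 := by simp
    have h2 : Countable (ℕ → Bool) := by
      rw [← Set.countable_univ_iff]
      exact Set.countable_of_injective_of_countable_image (f := g) hginj.injOn
        (by rwa [Set.image_univ])
    have h3 := Cardinal.mk_le_aleph0_iff.mpr h2
    exact (Cardinal.cantor _).not_ge (h4 ▸ h3)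
  refine h.boundedOn_of_forall_isGood le_rfl hT le_rfl fun x h1 h2 => ?_
  by_contra hbad
  exact (hempty ▸ (⟨⟨h1, h2⟩, hbad⟩ : x ∈ F) : x ∈ (∅ : Set ℝ))

end IsAlmostAdditive

/-- `g` is twice differentiable, and `g`, `g'`, `g''` are bounded by `M`. -/
structure IsCb2 (M : ℝ) (g : ℝ → ℝ) : Prop where
  diff : Differentiable ℝ g
  diff' : Differentiable ℝ (deriv g)
  bound : ∀ x, |g x| ≤ M
  bound' : ∀ x, |deriv g x| ≤ M
  bound'' : ∀ x, |deriv (deriv g) x| ≤ M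

theorem abs_sub_le_of_hasDerivAt {g g' : ℝ → ℝ} {C x y : ℝ} (hg : ∀ r, HasDerivAt g (g' r) r)
    (hC : ∀ r ∈ Set.uIcc x y, |g' r| ≤ C) : |g x - g y| ≤ C * |x - y| := by
  have := (convex_uIcc x y).norm_image_sub_le_of_norm_hasDerivWithin_le
    (fun r _ => (hg r).hasDerivWithinAt) hC Set.right_mem_uIcc Set.left_mem_uIcc
  simpa only [Real.norm_eq_abs] using this

theorem abs_le_of_mem_uIcc_zero {r h : ℝ} (hr : r ∈ Set.uIcc h 0) : |r| ≤ |h| := by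
  have := Set.abs_sub_right_of_mem_uIcc hr
  simpa using this

namespace IsCb2

variable {M : ℝ} {g : ℝ → ℝ}

theorem nonneg (hg : IsCb2 M g) : 0 ≤ M := (abs_nonneg _).trans (hg.bound 0)

theorem mono (hg : IsCb2 M g) {M' : ℝ} (h : M ≤ M') : IsCb2 M' g :=
  ⟨hg.diff, hg.diff', fun x => (hg.bound x).trans h, fun x => (hg.bound' x).trans h,
    fun x => (hg.bound'' x).trans h⟩

theorem mul (hg : IsCb2 M g) {k : ℝ → ℝ} (hk : IsCb2 M k) :
    IsCb2 (4 * M ^ 2) (fun x => g x * k x) := by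
  have hM := hg.nonneg
  have d1 : deriv (fun x => g x * k x) = fun x => deriv g x * k x + g x * deriv k x := by
    ext x
    exact ((hg.diff x).hasDerivAt.mul (hk.diff x).hasDerivAt).deriv
  have d2 : deriv (deriv fun x => g x * k x) = fun x =>
      (deriv (deriv g) x * k x + deriv g x * deriv k x)
        + (deriv g x * deriv k x + g x * deriv (deriv k) x) := by
    rw [d1]
    ext x
    exact (((hg.diff' x).hasDerivAt.mul (hk.diff x).hasDerivAt).add
      ((hg.diff x).hasDerivAt.mul (hk.diff' x).hasDerivAt)).deriv
  have hp : ∀ u v : ℝ, |u| ≤ M → |v| ≤ M → |u * v| ≤ M ^ 2 := fun u v hu hv => by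
    rw [abs_mul, sq]
    exact mul_le_mul hu hv (abs_nonneg _) hM
  have hM2 := sq_nonneg M
  refine ⟨hg.diff.mul hk.diff, ?_, fun x => ?_, fun x => ?_, fun x => ?_⟩
  · rw [d1]
    exact (hg.diff'.mul hk.diff).add (hg.diff.mul hk.diff')
  · linarith [hp _ _ (hg.bound x) (hk.bound x)]
  · rw [d1]
    have := abs_add_le (deriv g x * k x) (g x * deriv k x)
    linarith [hp _ _ (hg.bound' x) (hk.bound x), hp _ _ (hg.bound x) (hk.bound' x)]
  · rw [d2]
    have h1 := abs_add_le (deriv (deriv g) x * k x + deriv g x * deriv k x)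
      (deriv g x * deriv k x + g x * deriv (deriv k) x)
    have h2 := abs_add_le (deriv (deriv g) x * k x) (deriv g x * deriv k x)
    have h3 := abs_add_le (deriv g x * deriv k x) (g x * deriv (deriv k) x)
    simp only
    linarith [hp _ _ (hg.bound'' x) (hk.bound x), hp _ _ (hg.bound' x) (hk.bound' x),
      hp _ _ (hg.bound x) (hk.bound'' x)]

theorem abs_sub_le (hg : IsCb2 M g) (x y : ℝ) : |g x - g y| ≤ M * |x - y| :=
  abs_sub_le_of_hasDerivAt (fun r => (hg.diff r).hasDerivAt) fun r _ => hg.bound' r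

theorem abs_deriv_sub_le (hg : IsCb2 M g) (x y : ℝ) : |deriv g x - deriv g y| ≤ M * |x - y| :=
  abs_sub_le_of_hasDerivAt (fun r => (hg.diff' r).hasDerivAt) fun r _ => hg.bound'' r

theorem hasDerivAt_taylor (hg : IsCb2 M g) (x r : ℝ) :
    HasDerivAt (fun h => g (x + h) - g x - deriv g x * h) (deriv g (x + r) - deriv g x) r := by
  have h1 : HasDerivAt (fun h => g (x + h)) (deriv g (x + r)) r :=
    (hg.diff (x + r)).hasDerivAt.comp_const_add x r
  have h2 := (h1.sub_const (g x)).sub ((hasDerivAt_id r).const_mul (deriv g x))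
  rw [mul_one] at h2
  exact h2

theorem abs_taylor_le (hg : IsCb2 M g) (x h : ℝ) :
    |g (x + h) - g x - deriv g x * h| ≤ M * h ^ 2 := by
  have := abs_sub_le_of_hasDerivAt (x := h) (y := 0) (C := M * |h|)
    (fun r => hg.hasDerivAt_taylor x r) fun r hr => ?_
  · simp only [add_zero, sub_self, mul_zero, sub_zero] at this
    calc _ ≤ M * |h| * |h| := this
      _ = M * h ^ 2 := by rw [mul_assoc, ← sq, sq_abs]
  · refine (hg.abs_deriv_sub_le _ _).trans ?_
    rw [add_sub_cancel_left]
    exact mul_le_mul_of_nonneg_left (abs_le_of_mem_uIcc_zero hr) hg.nonneg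

/-- Lipschitz dependence of the first order Taylor remainder on its arguments. -/
theorem abs_taylor_sub_le (hg : IsCb2 M g) (hg' : IsCb2 M (deriv g)) (x h z k : ℝ) :
    |(g (x + h) - g x - deriv g x * h) - (g (z + k) - g z - deriv g z * k)| ≤
      M * h ^ 2 * |x - z| + M * (|h| + |k|) * |h - k| := by
  have e1 : |(g (x + h) - g x - deriv g x * h) - (g (z + h) - g z - deriv g z * h)| ≤
      M * h ^ 2 * |x - z| := by
    refine abs_sub_le_of_hasDerivAt (g := fun w => g (w + h) - g w - deriv g w * h)
      (g' := fun w => deriv g (w + h) - deriv g w - deriv (deriv g) w * h) (fun r => ?_)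
      fun r _ => hg'.abs_taylor_le r h
    exact (((hg.diff (r + h)).hasDerivAt.comp_add_const r h).sub (hg.diff r).hasDerivAt).sub
      ((hg.diff' r).hasDerivAt.mul_const h)
  have e2 : |(g (z + h) - g z - deriv g z * h) - (g (z + k) - g z - deriv g z * k)| ≤
      M * (|h| + |k|) * |h - k| := by
    refine abs_sub_le_of_hasDerivAt (fun r => hg.hasDerivAt_taylor z r) fun r hr => ?_
    refine (hg.abs_deriv_sub_le _ _).trans ?_
    rw [add_sub_cancel_left]
    refine mul_le_mul_of_nonneg_left ?_ hg.nonneg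
    rcases Set.mem_uIcc.mp hr with ⟨h1, h2⟩ | ⟨h1, h2⟩
    · exact (abs_le_max_abs_abs h1 h2).trans (max_le (by linarith [abs_nonneg k])
        (by linarith [abs_nonneg h]))
    · exact (abs_le_max_abs_abs h1 h2).trans (max_le (by linarith [abs_nonneg h])
        (by linarith [abs_nonneg k]))
  have := _root_.abs_sub_le (g (x + h) - g x - deriv g x * h) (g (z + h) - g z - deriv g z * h)
    (g (z + k) - g z - deriv g z * k)
  linarith

/-- Lipschitz dependence of increments on their arguments. -/
theorem abs_increment_sub_le (hg : IsCb2 M g) (x h z k : ℝ) :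
    |(g (x + h) - g x) - (g (z + k) - g z)| ≤ M * |h| * |x - z| + M * |h - k| := by
  have e1 : |(g (x + h) - g x) - (g (z + h) - g z)| ≤ M * |h| * |x - z| := by
    refine abs_sub_le_of_hasDerivAt (g := fun w => g (w + h) - g w)
      (g' := fun w => deriv g (w + h) - deriv g w) (fun r => ?_) fun r _ => ?_
    · exact ((hg.diff (r + h)).hasDerivAt.comp_add_const r h).sub (hg.diff r).hasDerivAt
    · simpa using hg.abs_deriv_sub_le (r + h) r
  have e2 : |(g (z + h) - g z) - (g (z + k) - g z)| ≤ M * |h - k| := by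
    simpa using hg.abs_sub_le (z + h) (z + k)
  have := _root_.abs_sub_le (g (x + h) - g x) (g (z + h) - g z) (g (z + k) - g z)
  linarith

end IsCb2

/-- The coefficients of the expansion are bounded with bounded derivatives. -/
structure BoundedCoeff {N : ℕ} (f : ℝ → (EuclideanSpace ℝ (Fin N) →L[ℝ] ℝ)) (M : ℝ) : Prop where
  nonneg : 0 ≤ M
  first : ∀ i, IsCb2 M (comp f i)
  first' : ∀ i, IsCb2 M (deriv (comp f i))
  second : ∀ i j, IsCb2 M (comp2 f i j)

theorem IsCb3.exists_boundedCoeff {N : ℕ} {f : ℝ → (EuclideanSpace ℝ (Fin N) →L[ℝ] ℝ)}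
    (hf : IsCb3 f) : ∃ M, BoundedCoeff f M := by
  choose! C hC using hf.bounded
  set c : ℕ → Fin N → ℝ → ℝ := fun k i x => iteratedDeriv k f x (EuclideanSpace.single i 1)
  have hd : ∀ k < 3, ∀ i x, HasDerivAt (c k i) (c (k + 1) i x) x := by
    intro k hk i x
    have h1 := (hf.differentiable k hk x).hasDerivAt
    have h2 := h1.clm_apply (hasDerivAt_const x (EuclideanSpace.single i (1 : ℝ)))
    simpa [c, iteratedDeriv_succ] using h2
  set M := max (max (C 0) (C 1)) (max (C 2) (C 3))
  have hb : ∀ k ≤ 3, ∀ i x, |c k i x| ≤ M := by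
    intro k hk i x
    have h1 := (iteratedDeriv k f x).le_opNorm (EuclideanSpace.single i (1 : ℝ))
    rw [show ‖EuclideanSpace.single i (1 : ℝ)‖ = 1 by simp, mul_one, Real.norm_eq_abs] at h1
    refine h1.trans ((hC k hk x).trans ?_)
    interval_cases k <;> simp [M]
  have h0 : ∀ i, comp f i = c 0 i := fun i => by ext x; simp [comp, c]
  have hder : ∀ k < 3, ∀ i, deriv (c k i) = c (k + 1) i := fun k hk i =>
    funext fun x => (hd k hk i x).deriv
  have hcb : ∀ k < 2, ∀ i, IsCb2 M (c k i) := by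
    intro k hk i
    refine ⟨fun x => (hd k (by omega) i x).differentiableAt, ?_, hb k (by omega) i, ?_, ?_⟩
    · rw [hder k (by omega)]
      exact fun x => (hd (k + 1) (by omega) i x).differentiableAt
    · rw [hder k (by omega)]
      exact hb (k + 1) (by omega) i
    · rw [hder k (by omega), hder (k + 1) (by omega)]
      exact hb (k + 2) (by omega) i
  have h1 : ∀ i, IsCb2 M (comp f i) := fun i => h0 i ▸ hcb 0 (by norm_num) i
  have h2 : ∀ i, IsCb2 M (deriv (comp f i)) := fun i => by
    rw [h0, hder 0 (by norm_num)]
    exact hcb 1 (by norm_num) i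
  exact ⟨max (max M (4 * M ^ 2)) 0, le_max_right _ _,
    fun i => (h1 i).mono ((le_max_left _ _).trans (le_max_left _ _)),
    fun i => (h2 i).mono ((le_max_left _ _).trans (le_max_left _ _)),
    fun i j => ((h1 i).mul (h2 j)).mono ((le_max_right _ _).trans (le_max_left _ _))⟩

section

section Sums

variable {N : ℕ}

theorem abs_sum_mul_le {a b : Fin N → ℝ} {A B : ℝ} (ha : ∀ i, |a i| ≤ A) (hb : ∀ i, |b i| ≤ B)
    (hA : 0 ≤ A) : |∑ i, a i * b i| ≤ N * (A * B) := by
  refine (Finset.abs_sum_le_sum_abs _ _).trans ?_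
  have : ∀ i ∈ Finset.univ, |a i * b i| ≤ A * B := fun i _ => by
    rw [abs_mul]
    exact mul_le_mul (ha i) (hb i) (abs_nonneg _) hA
  refine (Finset.sum_le_card_nsmul _ _ _ this).trans_eq ?_
  simp

theorem abs_sum_sum_mul_le {a b : Fin N → Fin N → ℝ} {A B : ℝ} (ha : ∀ i j, |a i j| ≤ A)
    (hb : ∀ i j, |b i j| ≤ B) (hA : 0 ≤ A) :
    |∑ i, ∑ j, a i j * b i j| ≤ N ^ 2 * (A * B) := by
  refine (Finset.abs_sum_le_sum_abs _ _).trans ?_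
  have : ∀ i ∈ Finset.univ, |∑ j, a i j * b i j| ≤ N * (A * B) := fun i _ =>
    abs_sum_mul_le (ha i) (hb i) hA
  refine (Finset.sum_le_card_nsmul _ _ _ this).trans_eq ?_
  simp [sq, mul_assoc]

end Sums

variable {N : ℕ} {p T : ℝ}

/-- The first order part of the expansion. -/
def germ₁ (f : ℝ → (EuclideanSpace ℝ (Fin N) →L[ℝ] ℝ)) (X : RoughPath N p T) (x s t : ℝ) : ℝ :=
  ∑ i, comp f i x * X.X1 s t i

/-- The second order part of the expansion. -/
def germ₂ (f : ℝ → (EuclideanSpace ℝ (Fin N) →L[ℝ] ℝ)) (X : RoughPath N p T) (x s t : ℝ) : ℝ :=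
  ∑ i, ∑ j, comp2 f i j x * X.X2 s t (i, j)

/-- The remainder in the expansion of `y`, set to zero on the diagonal. -/
def remainder (f : ℝ → (EuclideanSpace ℝ (Fin N) →L[ℝ] ℝ)) (X : RoughPath N p T) (y m : ℝ → ℝ)
    (s t : ℝ) : ℝ :=
  if s < t then y t - y s - germ₁ f X (y s) s t - germ₂ f X (y s) s t - (m t - m s) else 0

section Remainder

variable {f : ℝ → (EuclideanSpace ℝ (Fin N) →L[ℝ] ℝ)} {X : RoughPath N p T} {y m z n : ℝ → ℝ}
  {M s u t : ℝ}

theorem remainder_of_lt (hst : s < t) : remainder f X y m s t =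
    y t - y s - germ₁ f X (y s) s t - germ₂ f X (y s) s t - (m t - m s) := if_pos hst

theorem remainder_diag (f : ℝ → (EuclideanSpace ℝ (Fin N) →L[ℝ] ℝ)) (X : RoughPath N p T)
    (y m : ℝ → ℝ) (s : ℝ) : remainder f X y m s s = 0 := if_neg (lt_irrefl s)

theorem remainder_defect (hs : 0 ≤ s) (hsu : s < u) (hut : u < t) (ht : t ≤ T) :
    remainder f X y m s t - remainder f X y m s u - remainder f X y m u t =
      ∑ j, ((comp f j (y s + (y u - y s)) - comp f j (y s)
          - deriv (comp f j) (y s) * (y u - y s))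
          + deriv (comp f j) (y s) * (y u - y s - germ₁ f X (y s) s u)) * X.X1 u t j
      + ∑ i, ∑ j, (comp2 f i j (y s + (y u - y s)) - comp2 f i j (y s)) * X.X2 u t (i, j) := by
  have h1 : ∀ i, X.X1 s t i = X.X1 s u i + X.X1 u t i := fun i => by
    have := congrArg (fun v => v i) (X.additive s u t hs hsu hut ht)
    simp only [PiLp.sub_apply, PiLp.zero_apply] at this
    linarith
  have h2 : ∀ i j, X.X2 s t (i, j) = X.X2 s u (i, j) + X.X2 u t (i, j)
      + X.X1 s u i * X.X1 u t j := fun i j => by linarith [X.chen s u t hs hsu hut ht i j]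
  rw [remainder_of_lt (hsu.trans hut), remainder_of_lt hsu, remainder_of_lt hut]
  simp only [add_sub_cancel]
  have e1 : germ₁ f X (y s) s t = germ₁ f X (y s) s u + ∑ j, comp f j (y s) * X.X1 u t j := by
    simp only [germ₁, ← Finset.sum_add_distrib, h1, mul_add]
  have e2 : germ₂ f X (y s) s t = germ₂ f X (y s) s u
      + ∑ i, ∑ j, comp2 f i j (y s) * X.X2 u t (i, j)
      + ∑ j, deriv (comp f j) (y s) * germ₁ f X (y s) s u * X.X1 u t j := by
    have : ∑ j, deriv (comp f j) (y s) * germ₁ f X (y s) s u * X.X1 u t j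
        = ∑ i, ∑ j, comp2 f i j (y s) * (X.X1 s u i * X.X1 u t j) := by
      rw [Finset.sum_comm]
      refine Finset.sum_congr rfl fun j _ => ?_
      rw [germ₁, Finset.mul_sum, Finset.sum_mul]
      refine Finset.sum_congr rfl fun i _ => ?_
      rw [comp2]
      ring
    rw [this]
    simp only [germ₂, ← Finset.sum_add_distrib, h2, mul_add]
  rw [e1, e2]
  have e3 : ∑ j, ((comp f j (y u) - comp f j (y s) - deriv (comp f j) (y s) * (y u - y s))
      + deriv (comp f j) (y s) * (y u - y s - germ₁ f X (y s) s u)) * X.X1 u t j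
      = germ₁ f X (y u) u t - ∑ j, comp f j (y s) * X.X1 u t j
        - ∑ j, deriv (comp f j) (y s) * germ₁ f X (y s) s u * X.X1 u t j := by
    rw [show germ₁ f X (y u) u t = ∑ j, comp f j (y u) * X.X1 u t j from rfl,
      ← Finset.sum_sub_distrib, ← Finset.sum_sub_distrib]
    exact Finset.sum_congr rfl fun j _ => by ring
  have e4 : ∑ i, ∑ j, (comp2 f i j (y u) - comp2 f i j (y s)) * X.X2 u t (i, j)
      = germ₂ f X (y u) u t - ∑ i, ∑ j, comp2 f i j (y s) * X.X2 u t (i, j) := by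
    simp only [germ₂, ← Finset.sum_sub_distrib]
    exact Finset.sum_congr rfl fun i _ => Finset.sum_congr rfl fun j _ => by ring
  rw [e3, e4]
  ring

end Remainder

/-- A control dominating all the data of a solution. -/
structure IsDominating (X : RoughPath N p T) (y m : ℝ → ℝ) (ω : ℝ → ℝ → ℝ) : Prop where
  control : IsControl 0 T ω
  X1_le : ∀ s t, 0 ≤ s → s < t → t ≤ T → ‖X.X1 s t‖ ≤ ω s t ^ (1 / p)
  X2_le : ∀ s t, 0 ≤ s → s < t → t ≤ T → ‖X.X2 s t‖ ≤ ω s t ^ (1 / (p / 2))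
  y_le : ∀ s t, 0 ≤ s → s < t → t ≤ T → |y t - y s| ≤ ω s t ^ (1 / p)
  m_le : ∀ s t, 0 ≤ s → s < t → t ≤ T → |m t - m s| ≤ ω s t

theorem IsDominating.mono {X : RoughPath N p T} {y m : ℝ → ℝ} {ω ω' : ℝ → ℝ → ℝ} (hp : 0 < p)
    (h : IsDominating X y m ω) (h' : IsControl 0 T ω')
    (hle : ∀ s t, 0 ≤ s → s ≤ t → t ≤ T → ω s t ≤ ω' s t) : IsDominating X y m ω' := by
  have key : ∀ q : ℝ, 0 < q → ∀ s t, 0 ≤ s → s < t → t ≤ T → ω s t ^ (1 / q) ≤ ω' s t ^ (1 / q) :=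
    fun q hq s t h1 h2 h3 => Real.rpow_le_rpow (h.control.nonneg s t h1 h2.le h3)
      (hle s t h1 h2.le h3) (by positivity)
  exact ⟨h', fun s t h1 h2 h3 => (h.X1_le s t h1 h2 h3).trans (key _ hp s t h1 h2 h3),
    fun s t h1 h2 h3 => (h.X2_le s t h1 h2 h3).trans (key _ (by positivity) s t h1 h2 h3),
    fun s t h1 h2 h3 => (h.y_le s t h1 h2 h3).trans (key _ hp s t h1 h2 h3),
    fun s t h1 h2 h3 => (h.m_le s t h1 h2 h3).trans (hle s t h1 h2.le h3)⟩

theorem exists_isDominating (hp : 0 < p) (hT : 0 ≤ T) (X : RoughPath N p T) {y m : ℝ → ℝ}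
    (hy : MemV1 p (Set.Icc 0 T) y) (hm : MemV1 1 (Set.Icc 0 T) m) :
    ∃ ω, IsDominating X y m ω := by
  have h0 : (0 : ℝ) ∈ Set.Icc 0 T := ⟨le_rfl, hT⟩
  have hT' : T ∈ Set.Icc 0 T := ⟨hT, le_rfl⟩
  obtain ⟨κ₁, c1, b1⟩ := X.memX1.exists_control hp h0 hT'
  obtain ⟨κ₂, c2, b2⟩ := X.memX2.exists_control (by positivity) h0 hT'
  obtain ⟨κ₃, c3, b3⟩ := MemV2.exists_control hp hy h0 hT'
  obtain ⟨κ₄, c4, b4⟩ := MemV2.exists_control one_pos hm h0 hT'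
  refine ⟨fun s t => κ₁ s t + κ₂ s t + κ₃ s t + κ₄ s t, ((c1.add c2).add c3).add c4, ?_, ?_, ?_, ?_⟩
  all_goals
    intro s t hs hst ht
    have n1 := c1.nonneg s t hs hst.le ht
    have n2 := c2.nonneg s t hs hst.le ht
    have n3 := c3.nonneg s t hs hst.le ht
    have n4 := c4.nonneg s t hs hst.le ht
  · exact (b1 s t hs hst ht).trans (Real.rpow_le_rpow n1 (by linarith) (by positivity))
  · exact (b2 s t hs hst ht).trans (Real.rpow_le_rpow n2 (by linarith) (by positivity))
  · exact (b3 s t hs hst ht).trans (Real.rpow_le_rpow n3 (by linarith) (by positivity))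
  · have := b4 s t hs hst ht
    rw [div_one, Real.rpow_one] at this
    refine le_trans this ?_
    linarith

end

section

variable {N : ℕ} {p T : ℝ} {f : ℝ → (EuclideanSpace ℝ (Fin N) →L[ℝ] ℝ)} {X : RoughPath N p T}
  {y m z n : ℝ → ℝ} {M : ℝ} {ω : ℝ → ℝ → ℝ}

theorem abs_germ₁_le (hM : BoundedCoeff f M) {h s t : ℝ} (h1 : ∀ i, |X.X1 s t i| ≤ h) (x : ℝ) :
    |germ₁ f X x s t| ≤ N * (M * h) :=
  abs_sum_mul_le (fun i => (hM.first i).bound x) h1 hM.nonneg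

theorem abs_germ₂_le (hM : BoundedCoeff f M) {h s t : ℝ} (h2 : ∀ i j, |X.X2 s t (i, j)| ≤ h)
    (x : ℝ) : |germ₂ f X x s t| ≤ N ^ 2 * (M * h) :=
  abs_sum_sum_mul_le (fun i j => (hM.second i j).bound x) h2 hM.nonneg

theorem abs_germ₁_sub_le (hM : BoundedCoeff f M) {h s t : ℝ} (h1 : ∀ i, |X.X1 s t i| ≤ h)
    (x x' : ℝ) : |germ₁ f X x s t - germ₁ f X x' s t| ≤ N * (M * |x - x'| * h) := by
  simp only [germ₁, ← Finset.sum_sub_distrib, ← sub_mul]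
  exact abs_sum_mul_le (fun i => (hM.first i).abs_sub_le x x') h1
    (mul_nonneg hM.nonneg (abs_nonneg _))

theorem abs_germ₂_sub_le (hM : BoundedCoeff f M) {h s t : ℝ} (h2 : ∀ i j, |X.X2 s t (i, j)| ≤ h)
    (x x' : ℝ) : |germ₂ f X x s t - germ₂ f X x' s t| ≤ N ^ 2 * (M * |x - x'| * h) := by
  simp only [germ₂, ← Finset.sum_sub_distrib, ← sub_mul]
  exact abs_sum_sum_mul_le (fun i j => (hM.second i j).abs_sub_le x x') h2
    (mul_nonneg hM.nonneg (abs_nonneg _))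

/-- The size of the data over `[s, t]`, in terms of `h = ω(s,t)^(1/p)`. -/
structure DataBound (X : RoughPath N p T) (y m : ℝ → ℝ) (W s t h : ℝ) : Prop where
  X1_le : ∀ i, |X.X1 s t i| ≤ h
  X2_le : ∀ i j, |X.X2 s t (i, j)| ≤ h ^ 2
  y_le : |y t - y s| ≤ h
  m_le : |m t - m s| ≤ W * h ^ 2

theorem rpow_three_div {p x : ℝ} (hx : 0 ≤ x) : x ^ (3 / p) = (x ^ (1 / p)) ^ 3 := by
  rw [← Real.rpow_natCast, ← Real.rpow_mul hx]
  congr 1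
  push_cast
  ring

theorem IsDominating.dataBound (hp : 2 ≤ p) (h : IsDominating X y m ω) {s t : ℝ}
    (hs : 0 ≤ s) (hst : s < t) (ht : t ≤ T) :
    DataBound X y m (ω 0 T ^ (1 - 2 / p)) s t (ω s t ^ (1 / p)) := by
  have h0 := h.control.nonneg s t hs hst.le ht
  have hle : ω s t ≤ ω 0 T := h.control.mono le_rfl hs hst.le ht le_rfl
  have hsq : (ω s t ^ (1 / p)) ^ 2 = ω s t ^ (2 / p) := by
    rw [← Real.rpow_natCast, ← Real.rpow_mul h0]
    congr 1
    push_cast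
    ring
  refine ⟨fun i => ?_, fun i j => ?_, h.y_le s t hs hst ht, (h.m_le s t hs hst ht).trans ?_⟩
  · exact (PiLp.norm_apply_le (X.X1 s t) i).trans (h.X1_le s t hs hst ht)
  · refine (PiLp.norm_apply_le (X.X2 s t) (i, j)).trans ((h.X2_le s t hs hst ht).trans_eq ?_)
    rw [hsq]
    congr 1
    field_simp
  · rw [hsq]
    have h2 : 0 ≤ 1 - 2 / p := by
      rw [sub_nonneg, div_le_one (by linarith)]
      exact hp
    calc ω s t = ω s t ^ (1 - 2 / p + 2 / p) := by rw [sub_add_cancel, Real.rpow_one]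
      _ = ω s t ^ (1 - 2 / p) * ω s t ^ (2 / p) :=
        Real.rpow_add_of_nonneg h0 h2 (by positivity)
      _ ≤ _ := by gcongr

theorem DataBound.mono {W s t h h' : ℝ} (hW : 0 ≤ W) (hd : DataBound X y m W s t h) (h0 : 0 ≤ h)
    (hh : h ≤ h') : DataBound X y m W s t h' :=
  ⟨fun i => (hd.X1_le i).trans hh, fun i j => (hd.X2_le i j).trans (by gcongr), hd.y_le.trans hh,
    hd.m_le.trans (by gcongr)⟩

/-- The part of an increment not described by the first order germ. -/
theorem sharp_eq {s u : ℝ} (hsu : s < u) : y u - y s - germ₁ f X (y s) s u =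
    germ₂ f X (y s) s u + (m u - m s) + remainder f X y m s u := by
  rw [remainder_of_lt hsu]
  ring

theorem abs_sharp_le (hM : BoundedCoeff f M) {W s u h : ℝ} (hsu : s < u)
    (hd : DataBound X y m W s u h) :
    |y u - y s - germ₁ f X (y s) s u| ≤ (N ^ 2 * M + W) * h ^ 2 + |remainder f X y m s u| := by
  rw [sharp_eq (m := m) hsu]
  have h1 := abs_germ₂_le hM hd.X2_le (y s)
  have h2 := abs_add_three (germ₂ f X (y s) s u) (m u - m s) (remainder f X y m s u)
  linarith [hd.m_le]

theorem abs_remainder_defect_le (hM : BoundedCoeff f M) {W s u t h : ℝ} (hs : 0 ≤ s) (hsu : s < u)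
    (hut : u < t) (ht : t ≤ T) (h0 : 0 ≤ h) (hW : 0 ≤ W) (hd : DataBound X y m W s u h)
    (hd' : DataBound X y m W u t h) :
    |remainder f X y m s t - remainder f X y m s u - remainder f X y m u t| ≤
      (N * M * (1 + N ^ 2 * M + W) + N ^ 2 * M) * h ^ 3
        + N * M * h * |remainder f X y m s u| := by
  rw [remainder_defect hs hsu hut ht]
  have hM0 := hM.nonneg
  have hsh := abs_sharp_le hM hsu hd
  set r := |remainder f X y m s u|
  have hr : 0 ≤ r := abs_nonneg _
  set K := (N : ℝ) ^ 2 * M + W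
  have hK : 0 ≤ K := by positivity
  have e1 : ∀ j, |(comp f j (y s + (y u - y s)) - comp f j (y s)
      - deriv (comp f j) (y s) * (y u - y s))
      + deriv (comp f j) (y s) * (y u - y s - germ₁ f X (y s) s u)| ≤
      M * h ^ 2 + M * (K * h ^ 2 + r) := by
    intro j
    refine (abs_add_le _ _).trans (add_le_add ?_ ?_)
    · refine ((hM.first j).abs_taylor_le _ _).trans (mul_le_mul_of_nonneg_left ?_ hM0)
      rw [← sq_abs]
      exact pow_le_pow_left₀ (abs_nonneg _) hd.y_le 2
    · rw [abs_mul]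
      exact mul_le_mul ((hM.first j).bound' _) hsh (abs_nonneg _) hM0
  have e2 : ∀ i j, |comp2 f i j (y s + (y u - y s)) - comp2 f i j (y s)| ≤ M * h := by
    intro i j
    refine ((hM.second i j).abs_sub_le _ _).trans ?_
    rw [add_sub_cancel_left]
    exact mul_le_mul_of_nonneg_left hd.y_le hM0
  have s1 := abs_sum_mul_le e1 hd'.X1_le (by positivity)
  have s2 := abs_sum_sum_mul_le e2 hd'.X2_le (by positivity)
  refine (abs_add_le _ _).trans ((add_le_add s1 s2).trans_eq ?_)
  simp only [K]
  ring

theorem isAlmostAdditive_remainder (hp2 : 2 ≤ p) (hp3 : p < 3) (hT : 0 ≤ T)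
    (hM : BoundedCoeff f M) (h : IsDominating X y m ω) :
    ∃ L, IsAlmostAdditive T (3 / p) (1 / p) L ω (remainder f X y m) := by
  have hM0 := hM.nonneg
  have hp0 : 0 < p := by linarith
  have hω0 := h.control.nonneg 0 T le_rfl hT le_rfl
  set W := ω 0 T ^ (1 - 2 / p)
  set H := ω 0 T ^ (1 / p)
  have hW : 0 ≤ W := by positivity
  have hH : 0 ≤ H := by positivity
  set L₁ := N * M * (1 + N ^ 2 * M + W) + N ^ 2 * M
  set L₂ := N * M
  set L₃ := 1 + N * M + (N ^ 2 * M + W) * H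
  have hL₁ : 0 ≤ L₁ := by positivity
  have hL₂ : 0 ≤ L₂ := by positivity
  have hL₃ : 0 ≤ L₃ := by positivity
  refine ⟨L₁ + L₂ + L₃, h.control, (one_lt_div hp0).mpr hp3, by positivity, by positivity,
    remainder_diag f X y m, fun s t hs hst ht => ?_, fun s u t hs hsu hut ht => ?_⟩
  · have h0 := h.control.nonneg s t hs hst ht
    rcases hst.eq_or_lt with rfl | hst
    · rw [remainder_diag, abs_zero]
      positivity
    have hd := h.dataBound hp2 hs hst ht
    have hle : ω s t ^ (1 / p) ≤ H := Real.rpow_le_rpow h0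
      (h.control.mono le_rfl hs hst.le ht le_rfl) (by positivity)
    have hx0 : 0 ≤ ω s t ^ (1 / p) := by positivity
    set x := ω s t ^ (1 / p)
    have b1 := abs_germ₁_le hM hd.X1_le (y s)
    have b2 := abs_germ₂_le hM hd.X2_le (y s)
    have hd3 := hd.y_le
    have hd4 := hd.m_le
    change _ ≤ W * x ^ 2 at hd4
    have hx2 : x ^ 2 ≤ H * x := by rw [sq]; gcongr
    have hx3 : (N ^ 2 * M + W) * x ^ 2 ≤ (N ^ 2 * M + W) * (H * x) := by gcongr
    have tri : |remainder f X y m s t| ≤ |y t - y s| + |germ₁ f X (y s) s t|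
        + |germ₂ f X (y s) s t| + |m t - m s| := by
      rw [remainder_of_lt hst]
      refine (abs_sub _ _).trans (add_le_add_left ?_ _)
      refine (abs_sub _ _).trans (add_le_add_left ?_ _)
      exact abs_sub _ _
    calc |remainder f X y m s t| ≤ L₃ * x := by simp only [L₃]; linarith
      _ ≤ (L₁ + L₂ + L₃) * x := by gcongr; linarith
  · have h0 := h.control.nonneg s t hs (hsu.trans hut) ht
    rw [rpow_three_div h0]
    set x := ω s t ^ (1 / p)
    have hx0 : 0 ≤ x := by positivity
    rcases hsu.eq_or_lt with rfl | hsu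
    · rw [remainder_diag, sub_zero, sub_self, abs_zero, mul_zero, add_zero]
      positivity
    rcases hut.eq_or_lt with rfl | hut
    · rw [remainder_diag, sub_self, zero_sub, neg_zero, abs_zero]
      positivity
    have hd : DataBound X y m W s u x :=
      (h.dataBound hp2 hs hsu (hut.le.trans ht)).mono hW
        (Real.rpow_nonneg (h.control.nonneg s u hs hsu.le (hut.le.trans ht)) _)
        (Real.rpow_le_rpow (h.control.nonneg s u hs hsu.le (hut.le.trans ht))
          (h.control.mono hs le_rfl hsu.le hut.le ht) (by positivity))
    have hd' : DataBound X y m W u t x :=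
      (h.dataBound hp2 (hs.trans hsu.le) hut ht).mono hW
        (Real.rpow_nonneg (h.control.nonneg u t (hs.trans hsu.le) hut.le ht) _)
        (Real.rpow_le_rpow (h.control.nonneg u t (hs.trans hsu.le) hut.le ht)
          (h.control.mono hs hsu.le hut.le le_rfl ht) (by positivity))
    refine (abs_remainder_defect_le hM hs hsu hut ht hx0 hW hd hd').trans ?_
    change L₁ * x ^ 3 + L₂ * x * _ ≤ _
    gcongr <;> linarith

theorem IsSolution.exists_remainder_le {a : ℝ} (hp2 : 2 ≤ p) (hp3 : p < 3) (hT : 0 ≤ T)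
    (hM : BoundedCoeff f M) (hs : IsSolution f X a y m) (h : IsDominating X y m ω) :
    ∃ C, 0 ≤ C ∧ BoundedOn (remainder f X y m) ω (3 / p) C 0 T := by
  obtain ⟨L, hL⟩ := isAlmostAdditive_remainder hp2 hp3 hT hM h
  obtain ⟨ynat, ⟨J, hJo, hJs, hJc, hJv⟩, hexp⟩ := hs.expansion
  have hp0 : 0 < p / 3 := by linarith
  refine hL.boundedOn_of_locally hT J (fun x h1 h2 => Set.mem_iUnion.mp (hJc ⟨h1, h2⟩)) ?_
  intro k a' ha b hb hab
  have := hJo k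
  obtain ⟨ρ, hρ, hb'⟩ := (hJv k).exists_control hp0 ha hb
  refine ⟨ρ, hρ, fun s t h1 h2 h3 => ?_⟩
  rcases h2.eq_or_lt with rfl | h2
  · rw [remainder_diag, abs_zero]
    exact Real.rpow_nonneg (hρ.nonneg s s h1 le_rfl h3) _
  have e := hexp s t ((hJs k ha).1.trans h1) h2.le (h3.trans (hJs k hb).2)
  have e' : remainder f X y m s t = ynat s t := by
    rw [remainder_of_lt h2, germ₁, germ₂]
    linarith
  rw [e', ← one_div_div]
  exact hb' s t h1 h2 h3

/-- Defect of the difference of the remainders of two paths. -/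
theorem abs_remainder_sub_defect_le (hM : BoundedCoeff f M) {W H C S ν s u t h : ℝ} (hs : 0 ≤ s)
    (hsu : s < u) (hut : u < t) (ht : t ≤ T) (h0 : 0 ≤ h) (hH : h ≤ H) (hW : 0 ≤ W) (hC : 0 ≤ C)
    (hyu : DataBound X y m W s u h) (hzu : DataBound X z n W s u h)
    (hyt : DataBound X y m W u t h) (hS : |y s - z s| ≤ S) (hν : |(m u - m s) - (n u - n s)| ≤ ν)
    (hy : |remainder f X y m s u| ≤ C * h ^ 3) :
    |(remainder f X y m s t - remainder f X y m s u - remainder f X y m u t)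
        - (remainder f X z n s t - remainder f X z n s u - remainder f X z n u t)| ≤
      (N * M * (1 + 2 * N * M * (1 + N * H) + N ^ 2 * M + W + C * H + N ^ 2 * M)
          + N ^ 2 * M * (1 + N * M + N ^ 2 * M * H)) * S * h ^ 3
        + (N * M * (2 * H + 1) + N ^ 2 * M * H) * h *
          (ν + |remainder f X y m s u - remainder f X z n s u|) := by
  rw [remainder_defect hs hsu hut ht, remainder_defect hs hsu hut ht]
  have hM0 := hM.nonneg
  have hH0 : 0 ≤ H := h0.trans hH
  have hS0 : 0 ≤ S := (abs_nonneg _).trans hS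
  have hν0 : 0 ≤ ν := (abs_nonneg _).trans hν
  set r := |remainder f X y m s u - remainder f X z n s u| with hr
  have hr0 : 0 ≤ r := abs_nonneg _
  set ys := y u - y s - germ₁ f X (y s) s u with hys
  set zs := z u - z s - germ₁ f X (z s) s u with hzs
  set E := N ^ 2 * (M * S * h ^ 2) + (ν + r)
  have hE0 : 0 ≤ E := by positivity
  have hE : |ys - zs| ≤ E := by
    rw [hys, hzs, sharp_eq (m := m) hsu, sharp_eq (m := n) hsu]
    have h1 := abs_germ₂_sub_le hM hyu.X2_le (y s) (z s)
    have h2 := abs_add_three (germ₂ f X (y s) s u - germ₂ f X (z s) s u)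
      ((m u - m s) - (n u - n s)) (remainder f X y m s u - remainder f X z n s u)
    have h3 : (N : ℝ) ^ 2 * (M * |y s - z s| * h ^ 2) ≤ N ^ 2 * (M * S * h ^ 2) := by gcongr
    rw [show germ₂ f X (y s) s u + (m u - m s) + remainder f X y m s u
      - (germ₂ f X (z s) s u + (n u - n s) + remainder f X z n s u)
      = germ₂ f X (y s) s u - germ₂ f X (z s) s u + ((m u - m s) - (n u - n s))
        + (remainder f X y m s u - remainder f X z n s u) by ring]
    simp only [E]
    linarith
  set D := N * (M * S * h) + E
  have hD0 : 0 ≤ D := by positivity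
  have hD : |(y u - y s) - (z u - z s)| ≤ D := by
    have h1 := abs_germ₁_sub_le hM hyu.X1_le (y s) (z s)
    have h2 := abs_add_le (germ₁ f X (y s) s u - germ₁ f X (z s) s u) (ys - zs)
    have h3 : (N : ℝ) * (M * |y s - z s| * h) ≤ N * (M * S * h) := by gcongr
    rw [show (y u - y s) - (z u - z s) = germ₁ f X (y s) s u - germ₁ f X (z s) s u + (ys - zs) by
      rw [hys, hzs]; ring]
    simp only [D]
    linarith
  set K := N ^ 2 * M + W + C * H
  have hK0 : 0 ≤ K := by positivity
  have hysh : |ys| ≤ K * h ^ 2 := by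
    have h1 := abs_sharp_le hM hsu hyu
    have h2 : C * h ^ 3 ≤ C * H * h ^ 2 := by
      rw [pow_succ', ← mul_assoc]
      gcongr
    simp only [K]
    linarith
  set B := M * h ^ 2 * S + M * (h + h) * D + (M * S * (K * h ^ 2) + M * E)
  have hB0 : 0 ≤ B := by positivity
  have e1 : ∀ j, |((comp f j (y s + (y u - y s)) - comp f j (y s)
      - deriv (comp f j) (y s) * (y u - y s)) + deriv (comp f j) (y s) * ys)
      - ((comp f j (z s + (z u - z s)) - comp f j (z s)
      - deriv (comp f j) (z s) * (z u - z s)) + deriv (comp f j) (z s) * zs)| ≤ B := by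
    intro j
    rw [add_sub_add_comm]
    refine (abs_add_le _ _).trans (add_le_add ?_ ?_)
    · refine ((hM.first j).abs_taylor_sub_le (hM.first' j) _ _ _ _).trans ?_
      have h1 : (y u - y s) ^ 2 ≤ h ^ 2 := by
        rw [← sq_abs]
        exact pow_le_pow_left₀ (abs_nonneg _) hyu.y_le 2
      have h2 := hyu.y_le
      have h3 := hzu.y_le
      gcongr
    · rw [show deriv (comp f j) (y s) * ys - deriv (comp f j) (z s) * zs =
        (deriv (comp f j) (y s) - deriv (comp f j) (z s)) * ys
          + deriv (comp f j) (z s) * (ys - zs) by ring]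
      refine (abs_add_le _ _).trans (add_le_add ?_ ?_)
      · rw [abs_mul]
        refine mul_le_mul (((hM.first j).abs_deriv_sub_le _ _).trans ?_) hysh (abs_nonneg _)
          (by positivity)
        gcongr
      · rw [abs_mul]
        exact mul_le_mul ((hM.first j).bound' _) hE (abs_nonneg _) hM0
  have e2 : ∀ i j, |(comp2 f i j (y s + (y u - y s)) - comp2 f i j (y s))
      - (comp2 f i j (z s + (z u - z s)) - comp2 f i j (z s))| ≤ M * h * S + M * D := by
    intro i j
    refine ((hM.second i j).abs_increment_sub_le _ _ _ _).trans ?_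
    have h2 := hyu.y_le
    gcongr
  have s1 := abs_sum_mul_le e1 hyt.X1_le hB0
  have s2 := abs_sum_sum_mul_le e2 hyt.X2_le (by positivity)
  rw [add_sub_add_comm]
  simp only [← Finset.sum_sub_distrib, ← sub_mul]
  refine (abs_add_le _ _).trans ((add_le_add s1 s2).trans ?_)
  -- powers of `h` above the needed ones are absorbed into powers of `H`
  have hh2 : h ^ 2 ≤ H * h := by rw [sq]; gcongr
  have hh4 : h ^ 4 ≤ H * h ^ 3 := by rw [pow_succ' h 3]; gcongr
  have p1 : 0 ≤ (ν + r) * (2 * N * M + N ^ 2 * M) := by positivity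
  have p2 : 0 ≤ N * M * (2 * N ^ 2 * M * S) + N ^ 2 * M * (N ^ 2 * M * S) := by positivity
  have q1 := mul_le_mul_of_nonneg_left hh2 p1
  have q2 := mul_le_mul_of_nonneg_left hh4 p2
  have q3 : 0 ≤ N * M * (2 * N * M) * S * h ^ 3 := by positivity
  simp only [B, D, E, K]
  refine le_of_sub_nonneg ?_
  refine (add_nonneg (sub_nonneg.mpr q1) (sub_nonneg.mpr q2)).trans_eq ?_
  ring

end

section

variable {N : ℕ} {p T a : ℝ} {f : ℝ → (EuclideanSpace ℝ (Fin N) →L[ℝ] ℝ)} {X : RoughPath N p T}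
  {y m z n : ℝ → ℝ} {M : ℝ} {ω : ℝ → ℝ → ℝ}

theorem IsDominating.continuousOn (hp : 0 < p) (h : IsDominating X y m ω) :
    ContinuousOn y (Set.Icc 0 T) := by
  rw [Metric.continuousOn_iff]
  intro t ht ε hε
  obtain ⟨η, hη, H⟩ := exists_rpow_le (show 0 < 1 / p by positivity) (half_pos hε)
  obtain ⟨δ, hδ, H'⟩ := h.control.regular η hη
  have key : ∀ s t, 0 ≤ s → s < t → t ≤ T → t - s < δ → |y t - y s| < ε := by
    intro s t h1 h2 h3 h4
    have := H _ (h.control.nonneg s t h1 h2.le h3) (H' s t h1 h2.le h3 h4)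
    linarith [h.y_le s t h1 h2 h3]
  refine ⟨δ, hδ, fun s hs hst => ?_⟩
  rw [Real.dist_eq] at hst ⊢
  rw [abs_lt] at hst
  rcases lt_trichotomy s t with h1 | rfl | h1
  · rw [abs_sub_comm]
    exact key s t hs.1 h1 ht.2 (by linarith)
  · simpa using hε
  · exact key t s ht.1 h1 hs.2 (by linarith)

theorem IsDominating.isControl_increment (h : IsDominating X y m ω)
    (hm : MonotoneOn m (Set.Icc 0 T)) : IsControl 0 T (fun s t => m t - m s) where
  nonneg s t h1 h2 h3 := sub_nonneg.mpr (hm ⟨h1, h2.trans h3⟩ ⟨h1.trans h2, h3⟩ h2)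
  superadd s u t _ _ _ _ := by linarith
  regular ε hε := by
    obtain ⟨η, hη, H⟩ := h.control.regular ε hε
    refine ⟨η, hη, fun s t h1 h2 h3 h4 => ?_⟩
    rcases h2.eq_or_lt with rfl | h2
    · simpa using hε.le
    · exact (le_abs_self _).trans ((h.m_le s t h1 h2 h3).trans (H s t h1 h2.le h3 h4))

/-- The reflection measure does not charge intervals on which the path is positive. -/
theorem IsSolution.reflection_eq (h : IsSolution f X a y m) {s t : ℝ} (hs : 0 ≤ s) (hst : s ≤ t)
    (ht : t ≤ T) (hpos : ∀ u, s < u → u ≤ t → 0 < y u) : m t = m s := by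
  obtain ⟨μ, -, hμ⟩ := h.reflection
  have hs' : s ∈ Set.Icc 0 T := ⟨hs, hst.trans ht⟩
  have ht' : t ∈ Set.Icc 0 T := ⟨hs.trans hst, ht⟩
  have h1 := hμ t ht'
  rw [← Set.Icc_union_Ioc_eq_Icc hs hst, MeasureTheory.lintegral_union measurableSet_Ioc
    (Set.disjoint_left.mpr fun u hu hu' => not_lt.mpr hu.2 hu'.1), ← hμ s hs',
    MeasureTheory.setLIntegral_congr_fun (g := fun _ => 0) measurableSet_Ioc fun u hu =>
      Set.indicator_of_notMem (show u ∉ {u | y u = 0} from (hpos u hu.1 hu.2).ne') _,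
    MeasureTheory.lintegral_zero, add_zero] at h1
  exact (ENNReal.ofReal_eq_ofReal_iff (h.m_nonneg t ht') (h.m_nonneg s hs')).mp h1

theorem IsSolution.reflection_zero (h : IsSolution f X a y m) (hT : 0 ≤ T) (ha : 0 < a) :
    m 0 = 0 := by
  obtain ⟨μ, -, hμ⟩ := h.reflection
  have h0 : (0 : ℝ) ∈ Set.Icc 0 T := ⟨le_rfl, hT⟩
  have h1 := hμ 0 h0
  rw [MeasureTheory.setLIntegral_congr_fun (g := fun _ => 0) measurableSet_Icc fun u hu =>
      Set.indicator_of_notMem (show u ∉ {u | y u = 0} from ?_) _,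
    MeasureTheory.lintegral_zero, ENNReal.ofReal_eq_zero] at h1
  · exact le_antisymm h1 (h.m_nonneg 0 h0)
  · rw [Set.Icc_self, Set.mem_singleton_iff] at hu
    change y u ≠ 0
    rw [hu, h.init]
    exact ha.ne'

theorem interpolate_control {p l x μ : ℝ} (hp : 2 ≤ p) (hl : 0 < l) (hx : 0 ≤ x) (hμ : 0 ≤ μ)
    (hμ1 : μ ≤ 1) : x ^ (1 / p) * μ ≤ ((l ^ 2)⁻¹ * x + l * μ) ^ (3 / p) := by
  have hp0 : 0 < p := by linarith
  have h1 : μ ≤ μ ^ (2 / p) := by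
    rcases hμ.eq_or_lt with rfl | h
    · positivity
    · exact Real.self_le_rpow_of_le_one hμ hμ1 ((div_le_one hp0).mpr hp)
  have h2 : x ^ (1 / p) * μ ^ (2 / p) = ((l ^ 2)⁻¹ * x) ^ (1 / p) * (l * μ) ^ (2 / p) := by
    rw [Real.mul_rpow (by positivity) hx, Real.mul_rpow hl.le hμ, Real.inv_rpow (by positivity),
      ← Real.rpow_natCast l 2, ← Real.rpow_mul hl.le]
    have : ((2 : ℕ) : ℝ) * (1 / p) = 2 / p := by push_cast; ring
    rw [this]
    have : l ^ (2 / p) ≠ 0 := by positivity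
    field_simp
  calc x ^ (1 / p) * μ ≤ x ^ (1 / p) * μ ^ (2 / p) := by gcongr
    _ = ((l ^ 2)⁻¹ * x) ^ (1 / p) * (l * μ) ^ (2 / p) := h2
    _ ≤ ((l ^ 2)⁻¹ * x + l * μ) ^ (1 / p) * ((l ^ 2)⁻¹ * x + l * μ) ^ (2 / p) := by
      have : 0 ≤ l * μ := by positivity
      have : 0 ≤ (l ^ 2)⁻¹ * x := by positivity
      gcongr <;> linarith
    _ = _ := by
      rw [← Real.rpow_add_of_nonneg (by positivity) (by positivity) (by positivity)]
      congr 1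
      ring

/-- The difference of the remainders of two solutions, as an almost additive function. -/
theorem exists_remainder_sub_defect_le (hp2 : 2 ≤ p) (hT : 0 ≤ T)
    (hM : BoundedCoeff f M) (hy : IsDominating X y m ω) (hz : IsDominating X z n ω) {C : ℝ}
    (hC : 0 ≤ C) (hyC : BoundedOn (remainder f X y m) ω (3 / p) C 0 T) :
    ∃ L, 0 ≤ L ∧ ∀ s u t S ν, 0 ≤ s → s ≤ u → u ≤ t → t ≤ T → |y s - z s| ≤ S →
      |(m u - m s) - (n u - n s)| ≤ ν →
      |(remainder f X y m s t - remainder f X z n s t)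
          - (remainder f X y m s u - remainder f X z n s u)
          - (remainder f X y m u t - remainder f X z n u t)| ≤
        L * S * ω s t ^ (3 / p) + L * ω s t ^ (1 / p) *
          (ν + |remainder f X y m s u - remainder f X z n s u|) := by
  have hM0 := hM.nonneg
  have hp0 : 0 < p := by linarith
  have hω0 := hy.control.nonneg 0 T le_rfl hT le_rfl
  set W := ω 0 T ^ (1 - 2 / p)
  set H := ω 0 T ^ (1 / p)
  have hW : 0 ≤ W := by positivity
  have hH : 0 ≤ H := by positivity
  set L₁ := N * M * (1 + 2 * N * M * (1 + N * H) + N ^ 2 * M + W + C * H + N ^ 2 * M)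
          + N ^ 2 * M * (1 + N * M + N ^ 2 * M * H)
  set L₂ := N * M * (2 * H + 1) + N ^ 2 * M * H
  have hL₁ : 0 ≤ L₁ := by positivity
  have hL₂ : 0 ≤ L₂ := by positivity
  refine ⟨L₁ + L₂, by positivity, fun s u t S ν hs hsu hut ht hS hν => ?_⟩
  have hS0 : 0 ≤ S := (abs_nonneg _).trans hS
  have hν0 : 0 ≤ ν := (abs_nonneg _).trans hν
  have h0 := hy.control.nonneg s t hs (hsu.trans hut) ht
  have hsu0 := hy.control.nonneg s u hs hsu (hut.trans ht)
  have hut0 := hy.control.nonneg u t (hs.trans hsu) hut ht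
  have hR := hyC s u hs hsu (hut.trans ht)
  rw [rpow_three_div h0]
  rw [rpow_three_div hsu0] at hR
  have i1 : ω s u ^ (1 / p) ≤ ω s t ^ (1 / p) :=
    Real.rpow_le_rpow hsu0 (hy.control.mono hs le_rfl hsu hut ht) (by positivity)
  have i2 : ω u t ^ (1 / p) ≤ ω s t ^ (1 / p) :=
    Real.rpow_le_rpow hut0 (hy.control.mono hs hsu hut le_rfl ht) (by positivity)
  have i3 : ω s t ^ (1 / p) ≤ H := Real.rpow_le_rpow h0
      (hy.control.mono le_rfl hs (hsu.trans hut) ht le_rfl) (by positivity)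
  have j1 : 0 ≤ ω s u ^ (1 / p) := by positivity
  have j2 : 0 ≤ ω u t ^ (1 / p) := by positivity
  set x := ω s t ^ (1 / p)
  have hx0 : 0 ≤ x := by positivity
  rcases hsu.eq_or_lt with rfl | hsu
  · simp only [remainder_diag, sub_zero, sub_self, abs_zero]
    positivity
  rcases hut.eq_or_lt with rfl | hut
  · simp only [remainder_diag, sub_self, abs_zero]
    positivity
  have hd := (hy.dataBound hp2 hs hsu (hut.le.trans ht)).mono hW j1 i1
  have hd' := (hz.dataBound hp2 hs hsu (hut.le.trans ht)).mono hW j1 i1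
  have hd'' := (hy.dataBound hp2 (hs.trans hsu.le) hut ht).mono hW j2 i2
  have key := abs_remainder_sub_defect_le hM hs hsu hut ht hx0 i3 hW hC hd hd' hd'' hS hν
    (hR.trans (by gcongr))
  change _ ≤ L₁ * S * x ^ 3 + L₂ * x * (ν + _) at key
  rw [sub_sub_sub_comm (remainder f X y m s t), sub_sub_sub_comm]
  refine key.trans ?_
  gcongr <;> linarith

/-- Two solutions cannot separate: after a common value, `y` does not stay above `z`. -/
theorem IsSolution.not_lt_of_eq (hp2 : 2 ≤ p) (hp3 : p < 3) (hT : 0 ≤ T) (hM : BoundedCoeff f M)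
    (hy : IsSolution f X a y m) (hz : IsSolution f X a z n) (hωy : IsDominating X y m ω)
    (hωz : IsDominating X z n ω) {σ τ : ℝ} (hσ : 0 ≤ σ) (hστ : σ < τ) (hτ : τ ≤ T)
    (heq : y σ = z σ) : ¬ ∀ t, σ < t → t ≤ τ → z t < y t := by
  intro hlt
  have hp0 : 0 < p := by linarith
  have hω := hωy.control
  have hm : ∀ t, σ ≤ t → t ≤ τ → m t = m σ := fun t h1 h2 =>
    hy.reflection_eq hσ h1 (h2.trans hτ) fun u h3 h4 =>
      (hz.y_nonneg u ⟨hσ.trans h3.le, h4.trans (h2.trans hτ)⟩).trans_lt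
        (hlt u h3 (h4.trans h2))
  obtain ⟨C₁, hC₁, hR₁⟩ := hy.exists_remainder_le hp2 hp3 hT hM hωy
  obtain ⟨C₂, hC₂, hR₂⟩ := hz.exists_remainder_le hp2 hp3 hT hM hωz
  obtain ⟨L, hL, hdef⟩ := exists_remainder_sub_defect_le hp2 hT hM hωy hωz hC₁ hR₁
  have hθ : 1 < 3 / p := (one_lt_div hp0).mpr hp3
  obtain ⟨c, hc, hlam⟩ := exists_absorption_const hθ
  set A := 2 / (1 - (1 + c) * (2 : ℝ) ^ (1 - 3 / p))
  have hA : 0 ≤ A := div_nonneg (by norm_num) (by linarith)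
  -- choice of a small interval
  obtain ⟨η, hη, Hη⟩ := exists_rpow_le (show 0 < 3 / p by linarith)
    (show 0 < 1 / (4 * (A * (2 * L) + 1)) by positivity)
  set l := min 1 (η / 2)
  have hl : 0 < l := lt_min one_pos (by positivity)
  have hl1 : l ≤ 1 := min_le_left _ _
  have hlη : l ≤ η / 2 := min_le_right _ _
  obtain ⟨η', hη', Hη'⟩ := exists_rpow_le (show 0 < 1 / p by positivity)
    (show 0 < c / (L + 1) by positivity)
  obtain ⟨δ, hδ, Hδ⟩ := hω.regular (min (l ^ 3) η') (lt_min (by positivity) hη')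
  set b := min τ (σ + δ / 2)
  have hσb : σ < b := lt_min hστ (by linarith)
  have hbτ : b ≤ τ := min_le_left _ _
  have hbδ : b ≤ σ + δ / 2 := min_le_right _ _
  have hbT : b ≤ T := hbτ.trans hτ
  have hωb := Hδ σ b hσ hσb.le hbT (by linarith)
  rw [le_min_iff] at hωb
  have hωb0 := hω.nonneg σ b hσ hσb.le hbT
  -- the size of the difference
  have hcont : ContinuousOn (fun t => y t - z t) (Set.Icc σ b) :=
    ((hωy.continuousOn hp0).sub (hωz.continuousOn hp0)).mono (Set.Icc_subset_Icc hσ hbT)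
  obtain ⟨t₀, ht₀, hmax⟩ := isCompact_Icc.exists_isMaxOn ⟨b, hσb.le, le_rfl⟩ hcont
  have hD0 : ∀ t, σ ≤ t → t ≤ b → 0 ≤ y t - z t := fun t h1 h2 => by
    rcases h1.eq_or_lt with rfl | h1
    · rw [heq, sub_self]
    · linarith [hlt t h1 (h2.trans hbτ)]
  set S := y t₀ - z t₀
  have hS : ∀ t, σ ≤ t → t ≤ b → |y t - z t| ≤ S := fun t h1 h2 => by
    rw [abs_of_nonneg (hD0 t h1 h2)]
    exact hmax ⟨h1, h2⟩
  have hS0 : 0 < S := by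
    linarith [hlt b hσb hbτ, (le_abs_self _).trans (hS b hσb.le le_rfl)]
  have hn := hωz.isControl_increment hz.m_mono
  have hν0 : 0 ≤ n b - n σ := hn.nonneg σ b hσ hσb.le hbT
  set Q := S + (n b - n σ)
  have hQ : 0 < Q := by positivity
  set κ : ℝ → ℝ → ℝ := fun s t => (l ^ 2)⁻¹ * ω s t + l / Q * (n t - n s)
  have hκ : IsControl σ b κ := ((hω.const_mul (by positivity)).add
    (hn.const_mul (by positivity))).restrict hσ hbT
  set R : ℝ → ℝ → ℝ := fun s t => remainder f X y m s t - remainder f X z n s t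
  have hRρ : ∀ s t, σ ≤ s → s ≤ t → t ≤ b →
      |R s t| ≤ ((C₁ + C₂) ^ (1 / (3 / p)) * ω s t) ^ (3 / p) := by
    intro s t h1 h2 h3
    rw [rpow_one_div_mul_rpow (by linarith) (by positivity)
      (hω.nonneg s t (hσ.trans h1) h2 (h3.trans hbT))]
    refine (abs_sub _ _).trans ?_
    have := hR₁ s t (hσ.trans h1) h2 (h3.trans hbT)
    have := hR₂ s t (hσ.trans h1) h2 (h3.trans hbT)
    linarith
  have hδR : ∀ s u t, σ ≤ s → s ≤ u → u ≤ t → t ≤ b →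
      |R s t - R s u - R u t| ≤ 2 * L * Q * κ s t ^ (3 / p) + c * |R s u| := by
    intro s u t h1 h2 h3 h4
    have hs0 := hσ.trans h1
    have hst := h2.trans h3
    have htT := h4.trans hbT
    have hωst := hω.nonneg s t hs0 hst htT
    have hν : n u - n s ≤ n t - n s := hn.mono hs0 le_rfl h2 h3 htT
    have hν1 : 0 ≤ n u - n s := hn.nonneg s u hs0 h2 (h3.trans htT)
    have hν2 : n t - n s ≤ n b - n σ := hn.mono hσ h1 hst h4 hbT
    refine (hdef s u t S (n t - n s) hs0 h2 h3 htT (hS s h1 (hst.trans h4)) ?_).trans ?_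
    · rw [hm u (h1.trans h2) (h3.trans (h4.trans hbτ)), hm s h1 (hst.trans (h4.trans hbτ)),
        sub_self, zero_sub, abs_neg, abs_of_nonneg hν1]
      exact hν
    have k1 : S * ω s t ^ (3 / p) ≤ Q * κ s t ^ (3 / p) := by
      have : ω s t ≤ κ s t := by
        have e1 : 1 ≤ (l ^ 2)⁻¹ := (one_le_inv₀ (by positivity)).mpr (pow_le_one₀ hl.le hl1)
        have e2 : 0 ≤ l / Q * (n t - n s) := mul_nonneg (by positivity) (by linarith)
        simp only [κ]
        nlinarith
      have : S ≤ Q := by linarith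
      gcongr
    have k2 : ω s t ^ (1 / p) * (n t - n s) ≤ Q * κ s t ^ (3 / p) := by
      have := interpolate_control hp2 hl hωst (μ := (n t - n s) / Q)
        (div_nonneg (by linarith) hQ.le) ((div_le_one hQ).mpr (by linarith))
      rw [show l * ((n t - n s) / Q) = l / Q * (n t - n s) by ring] at this
      have e := mul_le_mul_of_nonneg_left this hQ.le
      refine le_of_eq_of_le ?_ e
      field_simp
    have k3 : L * ω s t ^ (1 / p) ≤ c := by
      have e := Hη' _ hωst ((hω.mono hσ h1 hst h4 hbT).trans hωb.2)
      rw [le_div_iff₀ (by positivity)] at e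
      have := Real.rpow_nonneg hωst (1 / p)
      linarith
    have k4 := mul_le_mul_of_nonneg_right k3 (abs_nonneg (R s u))
    have k5 := mul_le_mul_of_nonneg_left k1 hL
    have k6 := mul_le_mul_of_nonneg_left k2 hL
    change _ + _ * (_ + |R s u|) ≤ _
    linarith
  have hRle := abs_le_of_almost_additive hκ ((hω.const_mul (by positivity)).restrict hσ hbT)
    (by linarith) hc.le (by positivity) hlam hRρ hδR
  have hκb : κ σ b ^ (3 / p) ≤ 1 / (4 * (A * (2 * L) + 1)) := by
    refine Hη _ (hκ.nonneg σ b le_rfl hσb.le le_rfl) ?_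
    have e1 : (l ^ 2)⁻¹ * ω σ b ≤ l := by
      rw [inv_mul_le_iff₀ (by positivity)]
      calc ω σ b ≤ l ^ 3 := hωb.1
        _ = l ^ 2 * l := by ring
    have e2 : l / Q * (n b - n σ) ≤ l := by
      rw [div_mul_eq_mul_div, div_le_iff₀ hQ]
      have : n b - n σ ≤ Q := by linarith
      gcongr
    simp only [κ]
    linarith
  have hsmall : ∀ t, σ ≤ t → t ≤ b → (y t - z t) + (n t - n σ) ≤ Q / 4 := by
    intro t h1 h2
    rcases h1.eq_or_lt with rfl | h1
    · rw [heq, sub_self, sub_self, add_zero]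
      positivity
    have e1 : R σ t = (y t - z t) + (n t - n σ) := by
      simp only [R]
      rw [remainder_of_lt h1, remainder_of_lt h1, hm t h1.le (h2.trans hbτ), heq]
      ring
    have e2 := hRle σ t le_rfl h1.le h2
    have e3 : κ σ t ^ (3 / p) ≤ κ σ b ^ (3 / p) := Real.rpow_le_rpow
      (hκ.nonneg σ t le_rfl h1.le h2) (hκ.mono le_rfl le_rfl h1.le h2 le_rfl) (by linarith)
    rw [show 2 * (2 * L * Q) / (1 - (1 + c) * (2 : ℝ) ^ (1 - 3 / p)) = A * (2 * L) * Q by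
      simp only [A]; ring] at e2
    rw [← e1]
    calc R σ t ≤ |R σ t| := le_abs_self _
      _ ≤ A * (2 * L) * Q * (1 / (4 * (A * (2 * L) + 1))) :=
        e2.trans (mul_le_mul_of_nonneg_left (e3.trans hκb) (by positivity))
      _ ≤ (A * (2 * L) + 1) * Q * (1 / (4 * (A * (2 * L) + 1))) := by
        gcongr
        linarith
      _ = Q / 4 := by field_simp
  have f1 := hsmall t₀ ht₀.1 ht₀.2
  have f2 := hsmall b hσb.le le_rfl
  have f3 := hD0 b hσb.le le_rfl
  have f4 : 0 ≤ n t₀ - n σ := hn.nonneg σ t₀ hσ ht₀.1 (ht₀.2.trans hbT)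
  have f5 : Q = S + (n b - n σ) := rfl
  have f6 : S = y t₀ - z t₀ := rfl
  linarith

theorem IsSolution.le (hp2 : 2 ≤ p) (hp3 : p < 3) (hT : 0 ≤ T) (hM : BoundedCoeff f M)
    (hy : IsSolution f X a y m) (hz : IsSolution f X a z n) (hωy : IsDominating X y m ω)
    (hωz : IsDominating X z n ω) {τ : ℝ} (h0 : 0 ≤ τ) (hτ : τ ≤ T) : y τ ≤ z τ := by
  by_contra! hlt
  have hp0 : 0 < p := by linarith
  have hsub : Set.Icc 0 τ ⊆ Set.Icc 0 T := Set.Icc_subset_Icc_right hτ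
  have cy := (hωy.continuousOn hp0).mono hsub
  have cz := (hωz.continuousOn hp0).mono hsub
  set K : Set ℝ := {t ∈ Set.Icc 0 τ | y t ≤ z t}
  have hK : IsCompact K := isCompact_Icc.of_isClosed_subset
    (isClosed_Icc.isClosed_le cy cz) (Set.sep_subset _ _)
  have h0K : (0 : ℝ) ∈ K := ⟨⟨le_rfl, h0⟩, by rw [hy.init, hz.init]⟩
  have hσK := hK.sSup_mem ⟨0, h0K⟩
  set σ := sSup K
  have hστ : σ < τ := hσK.1.2.lt_of_ne fun h => absurd hσK.2 (by rw [h]; exact not_le.mpr hlt)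
  have hgt : ∀ t, σ < t → t ≤ τ → z t < y t := by
    intro t h1 h2
    by_contra! h3
    exact absurd (le_csSup hK.bddAbove ⟨⟨hσK.1.1.trans h1.le, h2⟩, h3⟩) (not_le.mpr h1)
  have hIoc : Set.Ioc σ τ ⊆ Set.Icc 0 τ := fun t ht => ⟨hσK.1.1.trans ht.1.le, ht.2⟩
  have heq : y σ = z σ := by
    refine le_antisymm hσK.2 (ContinuousWithinAt.closure_le (s := Set.Ioc σ τ) ?_
      ((cz σ hσK.1).mono hIoc) ((cy σ hσK.1).mono hIoc) fun t ht => (hgt t ht.1 ht.2).le)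
    rw [closure_Ioc hστ.ne]
    exact ⟨le_rfl, hστ.le⟩
  exact hy.not_lt_of_eq hp2 hp3 hT hM hz hωy hωz hσK.1.1 hστ hτ heq hgt

/-- For equal paths the reflection terms have the same increments. -/
theorem IsSolution.reflection_increment_eq (hp2 : 2 ≤ p) (hp3 : p < 3) (hT : 0 ≤ T)
    (hM : BoundedCoeff f M) (hy : IsSolution f X a y m) (hz : IsSolution f X a z n)
    (hωy : IsDominating X y m ω) (hωz : IsDominating X z n ω)
    (heq : ∀ t, 0 ≤ t → t ≤ T → y t = z t) {t : ℝ} (h0 : 0 ≤ t) (ht : t ≤ T) :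
    m t - m 0 = n t - n 0 := by
  have hp0 : 0 < p := by linarith
  obtain ⟨C₁, hC₁, hR₁⟩ := hy.exists_remainder_le hp2 hp3 hT hM hωy
  obtain ⟨C₂, hC₂, hR₂⟩ := hz.exists_remainder_le hp2 hp3 hT hM hωz
  have hθ : 1 < 3 / p := (one_lt_div hp0).mpr hp3
  have hω := hωy.control
  have key := abs_le_of_almost_additive (R := fun s t => (m t - m s) - (n t - n s)) hω
    (hω.const_mul (c := (C₁ + C₂) ^ (1 / (3 / p))) (by positivity)) (by linarith) le_rfl le_rfl
    (by
      rw [add_zero, one_mul]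
      exact Real.rpow_lt_one_of_one_lt_of_neg (by norm_num) (by linarith))
    (fun s t h1 h2 h3 => ?_)
    (fun s u t _ _ _ _ => by
      rw [show (m t - m s) - (n t - n s) - ((m u - m s) - (n u - n s))
        - ((m t - m u) - (n t - n u)) = 0 by ring]
      simp) 0 t le_rfl h0 ht
  · rw [mul_zero, zero_div, zero_mul] at key
    exact sub_eq_zero.mp (abs_nonpos_iff.mp key)
  · rw [rpow_one_div_mul_rpow (by linarith) (by positivity) (hω.nonneg s t h1 h2 h3)]
    rcases h2.eq_or_lt with rfl | h2
    · have := Real.rpow_nonneg (hω.nonneg s s h1 le_rfl h3) (3 / p)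
      simp only [sub_self, abs_zero]
      positivity
    have e : (m t - m s) - (n t - n s) = remainder f X z n s t - remainder f X y m s t := by
      rw [remainder_of_lt h2, remainder_of_lt h2, heq s h1 (h2.le.trans h3),
        heq t (h1.trans h2.le) h3]
      ring
    rw [e]
    refine (abs_sub _ _).trans ?_
    linarith [hR₁ s t h1 h2.le h3, hR₂ s t h1 h2.le h3]

end

end ReflectedRDE

end

theorem theorem3p1 (N : ℕ) (p T a : ℝ) (hp2 : 2 ≤ p) (hp3 : p < 3) (hT : 0 < T) (ha : 0 < a)
    (f : ℝ → (EuclideanSpace ℝ (Fin N) →L[ℝ] ℝ)) (hf : ReflectedRDE.IsCb3 f)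
    (X : ReflectedRDE.RoughPath N p T) (y m z n : ℝ → ℝ)
    (hym : ReflectedRDE.IsSolution f X a y m) (hzn : ReflectedRDE.IsSolution f X a z n) :
    Set.EqOn y z (Set.Icc 0 T) ∧ Set.EqOn m n (Set.Icc 0 T) := by
  have hp0 : 0 < p := by linarith
  obtain ⟨M, hM⟩ := hf.exists_boundedCoeff
  obtain ⟨ω₁, h₁⟩ := ReflectedRDE.exists_isDominating hp0 hT.le X hym.y_mem hym.m_mem
  obtain ⟨ω₂, h₂⟩ := ReflectedRDE.exists_isDominating hp0 hT.le X hzn.y_mem hzn.m_mem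
  have hω := h₁.control.add h₂.control
  have hy := h₁.mono hp0 hω fun s t e1 e2 e3 => by linarith [h₂.control.nonneg s t e1 e2 e3]
  have hz := h₂.mono hp0 hω fun s t e1 e2 e3 => by linarith [h₁.control.nonneg s t e1 e2 e3]
  have heq : ∀ t, 0 ≤ t → t ≤ T → y t = z t := fun t e1 e2 =>
    le_antisymm (hym.le hp2 hp3 hT.le hM hzn hy hz e1 e2)
      (hzn.le hp2 hp3 hT.le hM hym hz hy e1 e2)
  refine ⟨fun t ht => heq t ht.1 ht.2, fun t ht => ?_⟩
  have h := hym.reflection_increment_eq hp2 hp3 hT.le hM hzn hy hz heq ht.1 ht.2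
  rwa [hym.reflection_zero hT.le ha, hzn.reflection_zero hT.le ha, sub_zero, sub_zero] at h
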